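/- Let $\Omega^\bullet$ be a differential $*$-calculus over a $*$-algebra $B=\Omega^0$: a complex differential graded algebra generated in degree $0$, with a conjugate-linear graded involution $*$ commuting with $\mathrm d$. Let it carry a complex structure $\Omega^{(\bullet,\bullet)}$, $\mathrm d=\partial+\bar\partial$, and a Kähler structure $\kappa$ of total degree $2n$, $n\ge 1$: $\kappa$ is a closed, central, real $(1,1)$-form such that, for $L(\omega)=\kappa\wedge\omega$, the maps $L^{n-k}:\Omega^k\to\Omega^{2n-k}$ are isomorphisms for $0\le k<n$. Let $\ast_\kappa$ be its Hodge map, given on $\alpha\in\Omega^{(a,b)}$ with $a+b=k\le n$ and $L^{n-k+1}\alpha=0$ by the Weil formula $$\ast_\kappa(L^j\alpha)=(-1)^{k(k+1)/2}\,\mathbf i^{a-b}\,\tfrac{j!}{(n-j-k)!}\,L^{n-j-k}\alpha\qquad(0\le j\le n-k),$$ and let $g_\kappa(\omega,\nu)=\ast_\kappa(\omega\wedge\ast_\kappa(\nu^*))$ for forms of equal degree, and $0$ for forms of different degrees. Assume that $g_\kappa$ is positive definite, i.e. $g_\kappa(\omega,\omega)$ is a non-zero sum of elements $b^*b$ for every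 $\omega\ne0$. Let $\mathbf f:B\to\mathbb C$ be linear with $\mathbf f(b^*b)>0$ for $b\neq0$, and assume that the integral $\int=\mathbf f\circ\ast_\kappa$ is closed, i.e. $\int\circ\,\mathrm d$ vanishes on $\Omega^{2n-1}$. Let $\mathcal F$ be a finitely generated projective left $B$-module with an Hermitian structure $h$ (a right $B$-module isomorphism $\overline{\mathcal F}\to{}_B\mathrm{Hom}(\mathcal F,B)$ whose pairing satisfies $h(f,k)=h(k,f)^*$, with $h(f,f)$ a non-zero sum of elements $b^*b$ for $f\ne0$) and a flat $(0,1)$-connection $\bar\partial_{\mathcal F}$. Let $\nabla$ be its Chern connection (Hermitian, with $(0,1)$-part $\bar\partial_{\mathcal F}$) and $\partial_{\mathcal F}$ the $(1,0)$-part of $\nabla$, all extended to $\Omega^\bullet\otimes_B\mathcal F$ by the graded Leibniz rule. Assume that $\mathcal F$ is negative with constant $\theta>0$, that is, $\nabla^2(f)=\theta\,\mathbf i\,\kappa\otimes f$ for all $f\in\mathcal F$. Let $\langle\omega\otimes f,\nu\otimes k\rangle_{\mathcal F}=\mathbf f\big(g_\kappa(\omega\,h(f,k),\nu)\big)$. Suppose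 that there is a non-zero $\alpha\in\Omega^{(0,n-1)}\otimes_B\mathcal F$ with $\partial_{\mathcal F}\alpha=0$. Then: 1. $\bar\partial_{\mathcal F}$ has a unique adjoint $\bar\partial_{\mathcal F}^\dagger$ with respect to $\langle\cdot,\cdot\rangle_{\mathcal F}$, and $D_{\bar\partial_{\mathcal F}}=\bar\partial_{\mathcal F}+\bar\partial_{\mathcal F}^\dagger$ and $\Delta_{\bar\partial_{\mathcal F}}=D_{\bar\partial_{\mathcal F}}^2$ map $\Omega^{(0,\bullet)}\otimes_B\mathcal F$ to itself; 2. $\theta$ is an eigenvalue of $\Delta_{\bar\partial_{\mathcal F}}$, and $\sqrt\theta$ is an eigenvalue of $D_{\bar\partial_{\mathcal F}}$, on $\Omega^{(0,\bullet)}\otimes_B\mathcal F$; 3. the lower bounds are attained: if $\langle\cdot,\cdot\rangle_{\mathcal F}$ is an inner product (positive definite), then all non-zero eigenvalues of $\Delta_{\bar\partial_{\mathcal F}}$ on $\Omega^{(0,\bullet)}\otimes_B\mathcal F$ are real and at least $\theta$, and all non-zero eigenvalues of $D_{\bar\partial_{\mathcal F}}$ there have absolute value at least $\sqrt\theta$.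 -/

import Mathlib

open scoped TensorProduct

set_option linter.unusedSectionVars false

noncomputable section

namespace NCKahler

section Calculus

variable {Ω : Type*} [Ring Ω] [Algebra ℂ Ω]

/-- `δ (ω ∧ η) = δ ω ∧ η + (-1)^k ω ∧ δ η` for `ω` of degree `k`. -/
def IsGradedDerivation (𝒜 : ℕ → Submodule ℂ Ω) (δ : Ω →ₗ[ℂ] Ω) : Prop :=
  ∀ k, ∀ ω ∈ 𝒜 k, ∀ η, δ (ω * η) = δ ω * η + (-1 : ℂ) ^ k • (ω * δ η)

/-- A differential `*`-calculus `(Ω^•, d)`, with `Ω^k = 𝒜 k`, over the `*`-algebra `B = 𝒜 0`. -/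
structure StarCalculus (𝒜 : ℕ → Submodule ℂ Ω) [GradedAlgebra 𝒜] where
  /-- the exterior derivative -/
  d : Ω →ₗ[ℂ] Ω
  d_mem : ∀ k, ∀ ω ∈ 𝒜 k, d ω ∈ 𝒜 (k + 1)
  d_d : ∀ ω, d (d ω) = 0
  d_mul : IsGradedDerivation 𝒜 d
  generated : Algebra.adjoin ℂ ((𝒜 0 : Set Ω) ∪ d '' (𝒜 0 : Set Ω)) = ⊤
  /-- the `*`-map -/
  conj : Ω →ₛₗ[starRingEnd ℂ] Ω
  conj_conj : ∀ ω, conj (conj ω) = ω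
  conj_mem : ∀ k, ∀ ω ∈ 𝒜 k, conj ω ∈ 𝒜 k
  conj_d : ∀ ω, conj (d ω) = d (conj ω)
  conj_mul : ∀ k l, ∀ ω ∈ 𝒜 k, ∀ η ∈ 𝒜 l,
    conj (ω * η) = (-1 : ℂ) ^ (k * l) • (conj η * conj ω)

/-- The calculus has total degree `m`. -/
def HasTotalDegree (𝒜 : ℕ → Submodule ℂ Ω) (m : ℕ) : Prop :=
  𝒜 m ≠ ⊥ ∧ ∀ k, m < k → 𝒜 k = ⊥

/-- The grading involution `ω ↦ (-1)^k ω`, for `ω` of degree `k`. -/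
def sgn (𝒜 : ℕ → Submodule ℂ Ω) [GradedAlgebra 𝒜] : Ω →ₗ[ℂ] Ω :=
  DirectSum.toModule ℂ ℕ Ω (fun k => (-1 : ℂ) ^ k • (𝒜 k).subtype) ∘ₗ
    (DirectSum.decomposeLinearEquiv 𝒜).toLinearMap

theorem sgn_of_mem (𝒜 : ℕ → Submodule ℂ Ω) [GradedAlgebra 𝒜] {k : ℕ} {ω : Ω} (h : ω ∈ 𝒜 k) :
    sgn 𝒜 ω = (-1 : ℂ) ^ k • ω := by
  lift ω to 𝒜 k using h
  simp only [sgn, LinearMap.comp_apply, LinearEquiv.coe_coe, DirectSum.decomposeLinearEquiv_apply,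
    DirectSum.decompose_coe]
  exact (DirectSum.toModule_lof (M := fun k => 𝒜 k) ℂ k ω).trans rfl

/-- Additive properties can be checked on homogeneous elements. -/
theorem hom_induction {ι : Type*} [DecidableEq ι] [AddMonoid ι] (𝒢 : ι → Submodule ℂ Ω)
    [GradedAlgebra 𝒢] {P : Ω → Prop} (h0 : P 0)
    (hadd : ∀ x y, P x → P y → P (x + y)) (h : ∀ i, ∀ x ∈ 𝒢 i, P x) (x : Ω) : P x :=
  DirectSum.Decomposition.inductionOn 𝒢 h0 (fun {i} m => h i m m.2) (fun m m' => hadd m m') x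

variable {𝒜 : ℕ → Submodule ℂ Ω} [GradedAlgebra 𝒜]

theorem sgn_mul (ω : Ω) (b : 𝒜 0) : sgn 𝒜 (ω * b) = sgn 𝒜 ω * b := by
  refine hom_induction 𝒜 (P := fun ω => sgn 𝒜 (ω * b) = sgn 𝒜 ω * b) ?_ ?_ ?_ ω
  · simp
  · intro x y hx hy; simp [add_mul, hx, hy]
  · intro k x hx
    rw [sgn_of_mem 𝒜 hx, sgn_of_mem 𝒜 (by simpa using SetLike.mul_mem_graded hx b.2 : _ ∈ 𝒜 k)]
    simp

theorem IsGradedDerivation.sgn_rule {δ : Ω →ₗ[ℂ] Ω} (hδ : IsGradedDerivation 𝒜 δ) (ω η : Ω) :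
    δ (ω * η) = δ ω * η + sgn 𝒜 ω * δ η := by
  refine hom_induction 𝒜 (P := fun ω => δ (ω * η) = δ ω * η + sgn 𝒜 ω * δ η) ?_ ?_ ?_ ω
  · simp
  · intro x y hx hy; simp only [add_mul, map_add, hx, hy]; abel
  · intro k x hx
    rw [sgn_of_mem 𝒜 hx, hδ k x hx]
    simp

namespace StarCalculus

variable (C : StarCalculus 𝒜)

/-- The `*`-map of `B = Ω^0`. -/
def starB (b : 𝒜 0) : 𝒜 0 := ⟨C.conj b, C.conj_mem 0 b b.2⟩

theorem conj_mul_zero (ω : Ω) (b : 𝒜 0) : C.conj (ω * b) = C.conj b * C.conj ω := by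
  refine hom_induction 𝒜 (P := fun ω => C.conj (ω * b) = C.conj b * C.conj ω) ?_ ?_ ?_ ω
  · simp
  · intro x y hx hy; simp only [add_mul, map_add, hx, hy, mul_add]
  · intro k x hx
    rw [C.conj_mul k 0 x hx b b.2]; simp

theorem conj_one : C.conj 1 = 1 := by
  have h := C.conj_mul 0 0 1 SetLike.GradedOne.one_mem (C.conj 1)
    (C.conj_mem 0 1 SetLike.GradedOne.one_mem)
  simpa [C.conj_conj] using h.symm

theorem conj_zero_mul (b : 𝒜 0) (ω : Ω) : C.conj (b * ω) = C.conj ω * C.conj b := by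
  have h := C.conj_mul_zero (C.conj ω) (C.starB b)
  simp only [starB, C.conj_conj] at h
  rw [← h, C.conj_conj]

/-- The cone `B_{≥ 0}` of finite sums of elements `b^* b` (positive real coefficients can be
absorbed into `b`). -/
def nonnegCone : AddSubmonoid (𝒜 0) :=
  AddSubmonoid.closure {x | ∃ b : 𝒜 0, x = C.starB b * b}

/-- The non-zero elements `B_{> 0}` of the cone. -/
def IsPos (x : 𝒜 0) : Prop := x ∈ C.nonnegCone ∧ x ≠ 0

end StarCalculus

/-- A complex structure `Ω^{(a,b)} = 𝒷 (a,b)` on a differential `*`-calculus. The maps `∂` and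
`∂̄` are uniquely determined by the last three conditions. -/
structure ComplexStructure (C : StarCalculus 𝒜) (𝒷 : ℕ × ℕ → Submodule ℂ Ω)
    [GradedAlgebra 𝒷] where
  total : ∀ k, 𝒜 k = ⨆ (p : ℕ × ℕ) (_ : p.1 + p.2 = k), 𝒷 p
  conj_mem : ∀ a b, ∀ ω ∈ 𝒷 (a, b), C.conj ω ∈ 𝒷 (b, a)
  /-- the operator `∂` -/
  del : Ω →ₗ[ℂ] Ω
  /-- the operator `∂̄` -/
  delbar : Ω →ₗ[ℂ] Ω
  del_mem : ∀ a b, ∀ ω ∈ 𝒷 (a, b), del ω ∈ 𝒷 (a + 1, b)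
  delbar_mem : ∀ a b, ∀ ω ∈ 𝒷 (a, b), delbar ω ∈ 𝒷 (a, b + 1)
  d_eq : C.d = del + delbar

namespace ComplexStructure

variable {C : StarCalculus 𝒜} {𝒷 : ℕ × ℕ → Submodule ℂ Ω} [GradedAlgebra 𝒷]
  (X : ComplexStructure C 𝒷)

theorem mem_total (X : ComplexStructure C 𝒷) {a b : ℕ} {ω : Ω} (h : ω ∈ 𝒷 (a, b)) : ω ∈ 𝒜 (a + b) := by
  rw [X.total]
  exact Submodule.mem_iSup_of_mem (a, b) (Submodule.mem_iSup_of_mem rfl h)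

theorem bideg_zero (X : ComplexStructure C 𝒷) (b : 𝒜 0) : (b : Ω) ∈ 𝒷 0 := by
  have h := (X.total 0).le b.2
  refine (iSup₂_le ?_ : (⨆ (p : ℕ × ℕ) (_ : p.1 + p.2 = 0), 𝒷 p) ≤ 𝒷 0) h
  rintro ⟨a, c⟩ hp
  obtain ⟨rfl, rfl⟩ : a = 0 ∧ c = 0 := by simpa using hp
  exact le_rfl

theorem eq_zero_of_mem_mem {p q : ℕ × ℕ} (hpq : p ≠ q) {x : Ω} (hp : x ∈ 𝒷 p) (hq : x ∈ 𝒷 q) :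
    x = 0 := by
  by_contra hx
  exact hpq (DirectSum.degree_eq_of_mem_mem 𝒷 hp hq hx)

theorem del_and_delbar_rule {a b c e : ℕ} {ω η : Ω} (hω : ω ∈ 𝒷 (a, b)) (hη : η ∈ 𝒷 (c, e)) :
    X.del (ω * η) = X.del ω * η + (-1 : ℂ) ^ (a + b) • (ω * X.del η) ∧
    X.delbar (ω * η) = X.delbar ω * η + (-1 : ℂ) ^ (a + b) • (ω * X.delbar η) := by
  have h := C.d_mul (a + b) ω (X.mem_total hω) η
  simp only [X.d_eq, LinearMap.add_apply] at h
  have hm : ω * η ∈ 𝒷 (a + c, b + e) := SetLike.mul_mem_graded hω hη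
  have h1 : X.del (ω * η) - (X.del ω * η + (-1 : ℂ) ^ (a + b) • (ω * X.del η))
      ∈ 𝒷 (a + c + 1, b + e) := by
    refine sub_mem (X.del_mem _ _ _ hm) (add_mem ?_ (Submodule.smul_mem _ _ ?_))
    · have := SetLike.mul_mem_graded (X.del_mem _ _ _ hω) hη
      rwa [Prod.mk_add_mk, show a + 1 + c = a + c + 1 by ring] at this
    · exact SetLike.mul_mem_graded hω (X.del_mem _ _ _ hη)
  have h2 : X.delbar (ω * η) - (X.delbar ω * η + (-1 : ℂ) ^ (a + b) • (ω * X.delbar η))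
      ∈ 𝒷 (a + c, b + e + 1) := by
    refine sub_mem (X.delbar_mem _ _ _ hm) (add_mem ?_ (Submodule.smul_mem _ _ ?_))
    · have := SetLike.mul_mem_graded (X.delbar_mem _ _ _ hω) hη
      rwa [Prod.mk_add_mk, show b + 1 + e = b + e + 1 by ring] at this
    · exact SetLike.mul_mem_graded hω (X.delbar_mem _ _ _ hη)
  have h3 : X.del (ω * η) - (X.del ω * η + (-1 : ℂ) ^ (a + b) • (ω * X.del η)) =
      -(X.delbar (ω * η) - (X.delbar ω * η + (-1 : ℂ) ^ (a + b) • (ω * X.delbar η))) := by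
    simp only [add_mul, mul_add, smul_add] at h
    rw [← sub_eq_zero] at h ⊢
    rw [← h]; abel
  have h4 := eq_zero_of_mem_mem (by simp) h1 (h3 ▸ neg_mem h2)
  rw [h4] at h3
  exact ⟨sub_eq_zero.1 h4, sub_eq_zero.1 (neg_eq_zero.1 h3.symm)⟩

theorem hom_rule (X : ComplexStructure C 𝒷) (P : Ω → Ω → ℕ → Prop) (h0 : ∀ η k, P 0 η k) (h0' : ∀ ω k, P ω 0 k)
    (hadd : ∀ ω ω' η k, P ω η k → P ω' η k → P (ω + ω') η k)
    (hadd' : ∀ ω η η' k, P ω η k → P ω η' k → P ω (η + η') k)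
    (h : ∀ a b c e, ∀ ω ∈ 𝒷 (a, b), ∀ η ∈ 𝒷 (c, e), P ω η (a + b)) :
    ∀ k, ∀ ω ∈ 𝒜 k, ∀ η, P ω η k := by
  intro k ω hω η
  refine hom_induction 𝒷 (P := fun η => P ω η k) (h0' _ _) (fun x y => hadd' _ _ _ _) ?_ η
  rintro ⟨c, e⟩ η hη
  rw [X.total] at hω
  refine Submodule.iSup_induction (motive := fun ω => P ω η k) _ hω ?_ (h0 _ _)
    (fun x y => hadd _ _ _ _)
  rintro ⟨a, b⟩ ω hω
  by_cases hk : a + b = k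
  · subst hk
    simp only [iSup_pos] at hω
    exact h _ _ _ _ ω hω η hη
  · simp only [hk, iSup_neg, not_false_eq_true, Submodule.mem_bot] at hω
    exact hω ▸ h0 _ _

theorem del_derivation : IsGradedDerivation 𝒜 X.del := by
  refine X.hom_rule (fun ω η k => X.del (ω * η) = X.del ω * η + (-1 : ℂ) ^ k • (ω * X.del η))
    (by simp) (by simp) ?_ ?_ (fun a b c e ω hω η hη => (X.del_and_delbar_rule hω hη).1)
  · intro ω ω' η k h h'; simp only [add_mul, map_add, h, h', smul_add]; abel
  · intro ω η η' k h h'; simp only [mul_add, map_add, h, h', smul_add]; abel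

theorem delbar_derivation : IsGradedDerivation 𝒜 X.delbar := by
  refine X.hom_rule
    (fun ω η k => X.delbar (ω * η) = X.delbar ω * η + (-1 : ℂ) ^ k • (ω * X.delbar η))
    (by simp) (by simp) ?_ ?_ (fun a b c e ω hω η hη => (X.del_and_delbar_rule hω hη).2)
  · intro ω ω' η k h h'; simp only [add_mul, map_add, h, h', smul_add]; abel
  · intro ω η η' k h h'; simp only [mul_add, map_add, h, h', smul_add]; abel

theorem conj_del_and_delbar {a b : ℕ} {ω : Ω} (hω : ω ∈ 𝒷 (a, b)) :
    C.conj (X.del ω) = X.delbar (C.conj ω) ∧ C.conj (X.delbar ω) = X.del (C.conj ω) := by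
  have h := C.conj_d ω
  simp only [X.d_eq, LinearMap.add_apply, map_add] at h
  have hc := X.conj_mem _ _ _ hω
  have h1 : C.conj (X.del ω) - X.delbar (C.conj ω) ∈ 𝒷 (b, a + 1) :=
    sub_mem (X.conj_mem _ _ _ (X.del_mem _ _ _ hω)) (X.delbar_mem _ _ _ hc)
  have h2 : C.conj (X.delbar ω) - X.del (C.conj ω) ∈ 𝒷 (b + 1, a) :=
    sub_mem (X.conj_mem _ _ _ (X.delbar_mem _ _ _ hω)) (X.del_mem _ _ _ hc)
  have h3 : C.conj (X.del ω) - X.delbar (C.conj ω) = -(C.conj (X.delbar ω) - X.del (C.conj ω)) := by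
    rw [← sub_eq_zero] at h ⊢
    rw [← h]; abel
  have h4 := eq_zero_of_mem_mem (by simp) h1 (h3 ▸ neg_mem h2)
  rw [h4] at h3
  exact ⟨sub_eq_zero.1 h4, sub_eq_zero.1 (neg_eq_zero.1 h3.symm)⟩

theorem conj_del (ω : Ω) : C.conj (X.del ω) = X.delbar (C.conj ω) := by
  refine hom_induction 𝒷 (P := fun ω => C.conj (X.del ω) = X.delbar (C.conj ω)) (by simp)
    (fun x y hx hy => by simp only [map_add, hx, hy]) ?_ ω
  rintro ⟨a, b⟩ x hx
  exact (X.conj_del_and_delbar hx).1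

theorem conj_delbar (ω : Ω) : C.conj (X.delbar ω) = X.del (C.conj ω) := by
  refine hom_induction 𝒷 (P := fun ω => C.conj (X.delbar ω) = X.del (C.conj ω)) (by simp)
    (fun x y hx hy => by simp only [map_add, hx, hy]) ?_ ω
  rintro ⟨a, b⟩ x hx
  exact (X.conj_del_and_delbar hx).2

end ComplexStructure

end Calculus

section Modules

variable {Ω : Type*} [Ring Ω] [Algebra ℂ Ω] (𝒜 : ℕ → Submodule ℂ Ω) [GradedAlgebra 𝒜]
  (F : Type*) [AddCommGroup F] [Module ℂ F] [Module (𝒜 0) F]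

/-- The relations `ω b ⊗ f = ω ⊗ b f`, for `b ∈ B`. -/
def balancing : Submodule ℂ (Ω ⊗[ℂ] F) :=
  Submodule.span ℂ {x | ∃ (ω : Ω) (b : 𝒜 0) (f : F), x = (ω * b) ⊗ₜ[ℂ] f - ω ⊗ₜ[ℂ] (b • f)}

/-- The tensor product `Ω^• ⊗_B F` of the right `B`-module `Ω^•` and the left `B`-module `F`,
where `B = 𝒜 0`. -/
abbrev Twisted : Type _ := (Ω ⊗[ℂ] F) ⧸ balancing 𝒜 F

variable {F}

/-- `tmk 𝒜 ω f` is the element `ω ⊗ f` of `Ω^• ⊗_B F`. -/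
def tmk : Ω →ₗ[ℂ] F →ₗ[ℂ] Twisted 𝒜 F :=
  (TensorProduct.mk ℂ Ω F).compr₂ (balancing 𝒜 F).mkQ

variable {𝒜}

theorem tmk_bal (ω : Ω) (b : 𝒜 0) (f : F) : tmk 𝒜 (ω * b) f = tmk 𝒜 ω (b • f) := by
  rw [← sub_eq_zero]
  change (balancing 𝒜 F).mkQ _ - (balancing 𝒜 F).mkQ _ = 0
  rw [← map_sub, Submodule.mkQ_apply, Submodule.Quotient.mk_eq_zero]
  exact Submodule.subset_span ⟨ω, b, f, rfl⟩

theorem tw_induction {P : Twisted 𝒜 F → Prop} (h0 : P 0) (hadd : ∀ x y, P x → P y → P (x + y))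
    (h : ∀ ω f, P (tmk 𝒜 ω f)) (x : Twisted 𝒜 F) : P x := by
  obtain ⟨x, rfl⟩ := (balancing 𝒜 F).mkQ_surjective x
  induction x using TensorProduct.induction_on with
  | zero => simpa using h0
  | tmul ω f => exact h ω f
  | add x y hx hy => rw [map_add]; exact hadd _ _ hx hy

/-- The (semi)linear map on `Ω^• ⊗_B F` defined by a `B`-balanced map. -/
def twLift {V : Type*} [AddCommGroup V] [Module ℂ V] {σ : ℂ →+* ℂ} (g : Ω →ₛₗ[σ] F →ₛₗ[σ] V)
    (hg : ∀ (ω : Ω) (b : 𝒜 0) (f : F), g (ω * b) f = g ω (b • f)) : Twisted 𝒜 F →ₛₗ[σ] V :=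
  (balancing 𝒜 F).liftQ (TensorProduct.lift g) (Submodule.span_le.2 (by
    rintro _ ⟨ω, b, f, rfl⟩
    simp [hg]))

theorem twLift_tmk {V : Type*} [AddCommGroup V] [Module ℂ V] {σ : ℂ →+* ℂ}
    (g : Ω →ₛₗ[σ] F →ₛₗ[σ] V) (hg) (ω : Ω) (f : F) :
    twLift (𝒜 := 𝒜) g hg (tmk 𝒜 ω f) = g ω f := rfl

/-- `T ⊗ id_F`, for a right `B`-module map `T` on `Ω^•`. -/
def mapLeft (T : Ω →ₗ[ℂ] Ω) (hT : ∀ (ω : Ω) (b : 𝒜 0), T (ω * b) = T ω * b) :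
    Twisted 𝒜 F →ₗ[ℂ] Twisted 𝒜 F :=
  twLift ((tmk 𝒜).comp T) (fun ω b f => by simp [hT, tmk_bal])

theorem mapLeft_tmk (T : Ω →ₗ[ℂ] Ω) (hT) (ω : Ω) (f : F) :
    mapLeft (𝒜 := 𝒜) T hT (tmk 𝒜 ω f) = tmk 𝒜 (T ω) f := rfl

/-- Left multiplication `η ⊗ f ↦ (ω ∧ η) ⊗ f` on `Ω^• ⊗_B F`. -/
def lmulAux (ω : Ω) : Twisted 𝒜 F →ₗ[ℂ] Twisted 𝒜 F :=
  mapLeft (LinearMap.mulLeft ℂ ω) (fun η b => by simp [mul_assoc])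

theorem lmulAux_tmk (ω η : Ω) (f : F) : lmulAux ω (tmk 𝒜 η f) = tmk 𝒜 (ω * η) f := rfl

/-- Left multiplication on `Ω^• ⊗_B F` as a bilinear map. -/
def lmul : Ω →ₗ[ℂ] Twisted 𝒜 F →ₗ[ℂ] Twisted 𝒜 F where
  toFun := lmulAux
  map_add' ω ω' := LinearMap.ext fun x => by
    refine tw_induction (P := fun x => lmulAux (ω + ω') x = lmulAux ω x + lmulAux ω' x)
      (by simp) (fun x y hx hy => ?_) (fun η f => ?_) x
    · simp only [map_add, hx, hy]; abel
    · simp [lmulAux_tmk, add_mul]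
  map_smul' c ω := LinearMap.ext fun x => by
    refine tw_induction (P := fun x => lmulAux (c • ω) x = c • lmulAux ω x)
      (by simp) (fun x y hx hy => ?_) (fun η f => ?_) x
    · simp only [map_add, hx, hy, smul_add]
    · simp [lmulAux_tmk]

theorem lmul_tmk (ω η : Ω) (f : F) : lmul ω (tmk 𝒜 η f) = tmk 𝒜 (ω * η) f := rfl

theorem lmul_lmul (ω η : Ω) (x : Twisted 𝒜 F) : lmul ω (lmul η x) = lmul (ω * η) x := by
  refine tw_induction (P := fun x => lmul ω (lmul η x) = lmul (ω * η) x) (by simp)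
    (fun x y hx hy => ?_) (fun η f => ?_) x
  · simp only [map_add, hx, hy]
  · simp [lmul_tmk, mul_assoc]

variable (F) in
/-- The subspace `W ⊗_B F` of `Ω^• ⊗_B F`, for a subspace `W` of `Ω^•`. -/
def formsIn (W : Submodule ℂ Ω) : Submodule ℂ (Twisted 𝒜 F) :=
  Submodule.span ℂ {x | ∃ ω ∈ W, ∃ f : F, x = tmk 𝒜 ω f}

variable (𝒜 F) in
/-- A connection `F → W ⊗_B F` with respect to the differential `δ`, where `W` is the space of
`1`-forms of the calculus in question: `δ = d` and `W = Ω^1` for a connection, `δ = ∂̄` and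
`W = Ω^{(0,1)}` for a `(0,1)`-connection. -/
structure Connection (δ : Ω →ₗ[ℂ] Ω) (W : Submodule ℂ Ω) where
  /-- the underlying map -/
  map : F →ₗ[ℂ] Twisted 𝒜 F
  mem : ∀ f, map f ∈ formsIn F W
  leibniz : ∀ (b : 𝒜 0) (f : F), map (b • f) = tmk 𝒜 (δ b) f + lmul (b : Ω) (map f)

namespace Connection

variable {δ : Ω →ₗ[ℂ] Ω} {W : Submodule ℂ Ω}

/-- The extension `ω ⊗ f ↦ δ ω ⊗ f + (-1)^{|ω|} ω ∧ ∇ f` of a connection to `Ω^• ⊗_B F`. -/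
def ext (N : Connection 𝒜 F δ W) (hδ : IsGradedDerivation 𝒜 δ) :
    Twisted 𝒜 F →ₗ[ℂ] Twisted 𝒜 F :=
  twLift ((tmk 𝒜).comp δ + ((lmul.comp (sgn 𝒜)).compl₂ N.map)) (fun ω b f => by
    simp only [LinearMap.add_apply, LinearMap.comp_apply, LinearMap.compl₂_apply, N.leibniz,
      hδ.sgn_rule, sgn_mul, map_add, lmul_tmk, tmk_bal, lmul_lmul]
    abel)

theorem ext_tmk (N : Connection 𝒜 F δ W) (hδ : IsGradedDerivation 𝒜 δ) (ω : Ω) (f : F) :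
    N.ext hδ (tmk 𝒜 ω f) = tmk 𝒜 (δ ω) f + lmul (sgn 𝒜 ω) (N.map f) := rfl

/-- The curvature `∇² : F → Ω^2 ⊗_B F`. -/
def curvature (N : Connection 𝒜 F δ W) (hδ : IsGradedDerivation 𝒜 δ) : F →ₗ[ℂ] Twisted 𝒜 F :=
  N.ext hδ ∘ₗ N.map

end Connection

section Holomorphic

variable {C : StarCalculus 𝒜} {𝒷 : ℕ × ℕ → Submodule ℂ Ω} [GradedAlgebra 𝒷]

variable (F) in
/-- A holomorphic structure on `F`: a flat `(0,1)`-connection. -/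
structure HolomorphicStructure (X : ComplexStructure C 𝒷) extends
    Connection 𝒜 F X.delbar (𝒷 (0, 1)) where
  flat : toConnection.curvature X.delbar_derivation = 0

/-- The map `proj_{Ω^{(a,b)}} ⊗ id` on `Ω^• ⊗_B F`, for `p = (a,b)`. -/
def projF (X : ComplexStructure C 𝒷) (p : ℕ × ℕ) : Twisted 𝒜 F →ₗ[ℂ] Twisted 𝒜 F :=
  mapLeft (GradedAlgebra.proj 𝒷 p) (fun ω b => by
    simp only [GradedAlgebra.proj_apply]
    exact DirectSum.coe_decompose_mul_of_right_mem_zero 𝒷 (X.bideg_zero b))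

theorem projF_lmul (X : ComplexStructure C 𝒷) (p : ℕ × ℕ) (b : 𝒜 0) (x : Twisted 𝒜 F) :
    projF X p (lmul (b : Ω) x) = lmul (b : Ω) (projF X p x) := by
  refine tw_induction (P := fun x => projF X p (lmul (b : Ω) x) = lmul (b : Ω) (projF X p x))
    (by simp) (fun x y hx hy => by simp only [map_add, hx, hy]) (fun η f => ?_) x
  simp only [projF, mapLeft_tmk, lmul_tmk, GradedAlgebra.proj_apply]
  rw [DirectSum.coe_decompose_mul_of_left_mem_zero 𝒷 (X.bideg_zero b)]

theorem projF_mem (X : ComplexStructure C 𝒷) (p : ℕ × ℕ) (x : Twisted 𝒜 F) :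
    projF X p x ∈ formsIn F (𝒷 p) := by
  refine tw_induction (P := fun x => projF X p x ∈ formsIn F (𝒷 p))
    (by simp) (fun x y hx hy => by rw [map_add]; exact add_mem hx hy) (fun η f => ?_) x
  exact Submodule.subset_span ⟨_, by simp [GradedAlgebra.proj_apply], f, rfl⟩

/-- The connection `∂_F = (proj_{Ω^{(1,0)}} ⊗ id) ∘ ∇ : F → Ω^{(1,0)} ⊗_B F`. -/
def delPart (X : ComplexStructure C 𝒷) (N : Connection 𝒜 F C.d (𝒜 1)) :
    Connection 𝒜 F X.del (𝒷 (1, 0)) where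
  map := projF X (1, 0) ∘ₗ N.map
  mem f := projF_mem X _ _
  leibniz b f := by
    have h1 : X.del b ∈ 𝒷 (1, 0) := X.del_mem 0 0 _ (X.bideg_zero b)
    have h2 : X.delbar b ∈ 𝒷 (0, 1) := X.delbar_mem 0 0 _ (X.bideg_zero b)
    simp only [LinearMap.comp_apply, N.leibniz, map_add, projF_lmul, X.d_eq, LinearMap.add_apply]
    congr 1
    simp only [projF, mapLeft_tmk, GradedAlgebra.proj_apply]
    rw [DirectSum.decompose_of_mem_same 𝒷 h1, DirectSum.decompose_of_mem_ne 𝒷 h2 (by simp)]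
    simp

end Holomorphic

/-! ### Hermitian modules -/

variable (F) in
/-- An Hermitian module structure on the finitely generated projective left `B`-module `F`: an
isomorphism of right `B`-modules from the conjugate of `F` to the dual of `F`. The value
`toDual k f` is `h_F(f, k)`. -/
structure HermitianModule (C : StarCalculus 𝒜) where
  /-- the isomorphism onto the dual module -/
  toDual : F → (F →ₗ[𝒜 0] 𝒜 0)
  toDual_add : ∀ k k', toDual (k + k') = toDual k + toDual k'
  toDual_smul : ∀ (b : 𝒜 0) (k f : F), toDual (b • k) f = toDual k f * C.starB b
  bijective : Function.Bijective toDual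
  symm : ∀ f k, toDual k f = C.starB (toDual f k)
  pos : ∀ f, f ≠ 0 → C.IsPos (toDual f f)

namespace HermitianModule

variable {C : StarCalculus 𝒜} [IsScalarTower ℂ (𝒜 0) F] (H : HermitianModule F C)

/-- The map `ω ⊗ f ↦ ω h_F(f, k)`. -/
def contract (k : F) : Twisted 𝒜 F →ₗ[ℂ] Ω :=
  twLift (LinearMap.mk₂ ℂ (fun ω f => ω * (H.toDual k f : 𝒜 0))
    (fun x y f => add_mul x y _) (fun c x f => by simp)
    (fun x f g => by simp [mul_add])
    (fun c x f => by
      rw [← smul_one_smul (𝒜 0) c f, map_smul]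
      simp))
    (fun ω b f => by simp [mul_assoc])


theorem contract_tmk (k : F) (ω : Ω) (f : F) :
    H.contract k (tmk 𝒜 ω f) = ω * (H.toDual k f : 𝒜 0) := rfl

theorem contract_add (k k' : F) (x : Twisted 𝒜 F) :
    H.contract (k + k') x = H.contract k x + H.contract k' x := by
  refine tw_induction (P := fun x => H.contract (k + k') x = H.contract k x + H.contract k' x)
    (by simp) (fun x y hx hy => by simp only [map_add, hx, hy]; abel) (fun ω f => ?_) x
  simp [contract_tmk, H.toDual_add, mul_add]

theorem contract_smul_zero (b : 𝒜 0) (k : F) (x : Twisted 𝒜 F) :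
    H.contract (b • k) x = H.contract k x * C.conj b := by
  refine tw_induction (P := fun x => H.contract (b • k) x = H.contract k x * C.conj b)
    (by simp) (fun x y hx hy => by simp only [map_add, hx, hy, add_mul]) (fun ω f => ?_) x
  simp [contract_tmk, H.toDual_smul, StarCalculus.starB, mul_assoc]

theorem contract_smul (c : ℂ) (k : F) (x : Twisted 𝒜 F) :
    H.contract (c • k) x = starRingEnd ℂ c • H.contract k x := by
  rw [← smul_one_smul (𝒜 0) c k, H.contract_smul_zero]
  simp [C.conj_one]

/-- The map `ν ⊗ k ↦ S (ω h_F(f, k), ν)` for fixed `x = ω ⊗ f`. -/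
def pairingRight {V : Type*} [AddCommGroup V] [Module ℂ V]
    (S : Ω →ₗ[ℂ] Ω →ₛₗ[starRingEnd ℂ] V)
    (hS : ∀ (ω : Ω) (b : 𝒜 0) (ν : Ω), S (ω * b) ν = S ω (ν * C.conj b)) (x : Twisted 𝒜 F) :
    Twisted 𝒜 F →ₛₗ[starRingEnd ℂ] V :=
  twLift (LinearMap.mk₂'ₛₗ (starRingEnd ℂ) (starRingEnd ℂ) (fun ν k => S (H.contract k x) ν)
      (fun ν ν' k => by simp) (fun c ν k => by simp)
      (fun ν k k' => by simp [contract_add]) (fun c ν k => by simp [contract_smul]))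
    (fun ν b k => by
      simp only [LinearMap.mk₂'ₛₗ_apply, contract_smul_zero]
      exact (by simpa [StarCalculus.starB, C.conj_conj] using hS (H.contract k x) (C.starB b) ν :
        S (H.contract k x * C.conj b) ν = S (H.contract k x) (ν * b)).symm)

theorem pairingRight_tmk {V : Type*} [AddCommGroup V] [Module ℂ V]
    (S : Ω →ₗ[ℂ] Ω →ₛₗ[starRingEnd ℂ] V) (hS) (x : Twisted 𝒜 F) (ν : Ω) (k : F) :
    H.pairingRight S hS x (tmk 𝒜 ν k) = S (H.contract k x) ν := rfl

/-- The sesquilinear pairing `(ω ⊗ f, ν ⊗ k) ↦ S (ω h_F(f, k), ν)` on `Ω^• ⊗_B F` determined by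
a sesquilinear pairing `S` on `Ω^•` for which `S (ω b, ν) = S (ω, ν b^*)`. -/
def pairing {V : Type*} [AddCommGroup V] [Module ℂ V] (S : Ω →ₗ[ℂ] Ω →ₛₗ[starRingEnd ℂ] V)
    (hS : ∀ (ω : Ω) (b : 𝒜 0) (ν : Ω), S (ω * b) ν = S ω (ν * C.conj b)) :
    Twisted 𝒜 F →ₗ[ℂ] Twisted 𝒜 F →ₛₗ[starRingEnd ℂ] V where
  toFun := H.pairingRight S hS
  map_add' x x' := LinearMap.ext fun y => by
    refine tw_induction (P := fun y => H.pairingRight S hS (x + x') y =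
        H.pairingRight S hS x y + H.pairingRight S hS x' y) (by simp)
      (fun y y' h h' => by simp only [map_add (H.pairingRight S hS _), h, h']; abel)
      (fun ν k => ?_) y
    simp [pairingRight_tmk]
  map_smul' c x := LinearMap.ext fun y => by
    refine tw_induction (P := fun y => H.pairingRight S hS (c • x) y =
        c • H.pairingRight S hS x y) (by simp)
      (fun y y' h h' => by simp only [map_add (H.pairingRight S hS _), h, h', smul_add])
      (fun ν k => ?_) y
    simp [pairingRight_tmk]

theorem pairing_tmk {V : Type*} [AddCommGroup V] [Module ℂ V]
    (S : Ω →ₗ[ℂ] Ω →ₛₗ[starRingEnd ℂ] V) (hS) (x : Twisted 𝒜 F) (ν : Ω) (k : F) :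
    H.pairing S hS x (tmk 𝒜 ν k) = S (H.contract k x) ν := rfl

variable (C) in
/-- The pairing `(ω, ν) ↦ ω ∧ ν^*`. -/
def wedgePairing : Ω →ₗ[ℂ] Ω →ₛₗ[starRingEnd ℂ] Ω :=
  LinearMap.mk₂'ₛₗ (RingHom.id ℂ) (starRingEnd ℂ) (fun ω ν => ω * C.conj ν)
    (fun _ _ _ => add_mul _ _ _) (fun _ _ _ => by simp) (fun _ _ _ => by simp [mul_add])
    (fun _ _ _ => by simp)

/-- The extension `h_F (ω ⊗ f, ν ⊗ k) = ω h_F(f, k) ∧ ν^*` of the Hermitian structure. -/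
def hermForm : Twisted 𝒜 F →ₗ[ℂ] Twisted 𝒜 F →ₛₗ[starRingEnd ℂ] Ω :=
  H.pairing (wedgePairing C) (fun ω b ν => by
    have := C.conj_mul_zero ν (C.starB b)
    simp only [StarCalculus.starB, C.conj_conj] at this
    simp [wedgePairing, this, mul_assoc])

theorem hermForm_tmk (x : Twisted 𝒜 F) (ν : Ω) (k : F) :
    H.hermForm x (tmk 𝒜 ν k) = H.contract k x * C.conj ν := rfl

/-- The Chern connection: the Hermitian connection whose `(0,1)`-part is `∂̄_F`. -/
structure IsChern {𝒷 : ℕ × ℕ → Submodule ℂ Ω} [GradedAlgebra 𝒷] {X : ComplexStructure C 𝒷}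
    (hol : HolomorphicStructure F X) (N : Connection 𝒜 F C.d (𝒜 1)) : Prop where
  hermitian : ∀ f k, C.d (H.toDual k f : 𝒜 0) =
    H.hermForm (N.map f) (tmk 𝒜 1 k) + H.hermForm (tmk 𝒜 1 f) (N.map k)
  proj_eq : ∀ f, hol.map f = projF X (0, 1) (N.map f)

/-! #### Existence of the Chern connection -/

theorem symm_coe (f k : F) : ((H.toDual k f : 𝒜 0) : Ω) = C.conj (H.toDual f k : 𝒜 0) := by
  rw [H.symm f k]; rfl

theorem conj_contract (f : F) (x : Twisted 𝒜 F) :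
    C.conj (H.contract f x) = H.hermForm (tmk 𝒜 1 f) x := by
  refine tw_induction (P := fun x => C.conj (H.contract f x) = H.hermForm (tmk 𝒜 1 f) x)
    (by simp) (fun x y hx hy => by simp only [map_add, hx, hy]) (fun ω k => ?_) x
  rw [hermForm_tmk, contract_tmk, contract_tmk, C.conj_mul_zero, ← symm_coe, one_mul]

theorem hermForm_one_right (f : F) (x : Twisted 𝒜 F) :
    H.hermForm x (tmk 𝒜 1 f) = H.contract f x := by
  rw [hermForm_tmk, C.conj_one, mul_one]

theorem hermForm_lmul_right (b : 𝒜 0) (x y : Twisted 𝒜 F) :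
    H.hermForm x (lmul (b : Ω) y) = H.hermForm x y * C.conj b := by
  refine tw_induction
    (P := fun y => H.hermForm x (lmul (b : Ω) y) = H.hermForm x y * C.conj b)
    (by simp) (fun y y' h h' => by simp only [map_add, h, h', add_mul]) (fun ω k => ?_) y
  rw [lmul_tmk, hermForm_tmk, hermForm_tmk, C.conj_zero_mul, mul_assoc]

section ChernExistence

variable {𝒷 : ℕ × ℕ → Submodule ℂ Ω} [GradedAlgebra 𝒷] {X : ComplexStructure C 𝒷}
  (hol : HolomorphicStructure F X)

/-- The `(1,0)`-form `∂ h_F(f, k) - h_F(f, ∂̄_F k)`. -/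
def chernAux (k : F) : F →ₗ[ℂ] Ω where
  toFun f := X.del (H.contract k (tmk 𝒜 1 f)) - H.hermForm (tmk 𝒜 1 f) (hol.map k)
  map_add' f g := by simp only [map_add, LinearMap.add_apply]; abel
  map_smul' c f := by simp only [map_smul, LinearMap.smul_apply, smul_sub, RingHom.id_apply]

theorem chernAux_apply (k f : F) : H.chernAux hol k f =
    X.del (H.toDual k f : 𝒜 0) - H.hermForm (tmk 𝒜 1 f) (hol.map k) := by
  simp [chernAux, contract_tmk]

theorem hermForm_mem (X : ComplexStructure C 𝒷) (f : F) {x : Twisted 𝒜 F} (hx : x ∈ formsIn F (𝒷 (0, 1))) :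
    H.hermForm (tmk 𝒜 1 f) x ∈ 𝒷 (1, 0) := by
  refine Submodule.span_induction (p := fun x _ => H.hermForm (tmk 𝒜 1 f) x ∈ 𝒷 (1, 0))
    ?_ (by simp) (fun x y _ _ h h' => by rw [map_add]; exact add_mem h h')
    (fun c x _ h => by rw [map_smulₛₗ]; exact Submodule.smul_mem _ _ h) hx
  rintro _ ⟨ω, hω, k, rfl⟩
  rw [hermForm_tmk, contract_tmk, one_mul]
  simpa using SetLike.mul_mem_graded (X.bideg_zero (H.toDual k f)) (X.conj_mem _ _ _ hω)

theorem chernAux_mem (k f : F) : H.chernAux hol k f ∈ 𝒷 (1, 0) := by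
  rw [chernAux_apply]
  exact sub_mem (X.del_mem 0 0 _ (X.bideg_zero _)) (H.hermForm_mem X f (hol.mem k))

theorem chernAux_add (k k' f : F) :
    H.chernAux hol (k + k') f = H.chernAux hol k f + H.chernAux hol k' f := by
  simp only [chernAux_apply, H.toDual_add, LinearMap.add_apply, map_add, Submodule.coe_add]
  abel

theorem chernAux_smul_left (b : 𝒜 0) (k f : F) :
    H.chernAux hol (b • k) f = H.chernAux hol k f * C.conj b := by
  have h := X.del_derivation 0 _ (H.toDual k f).2 (C.conj b)
  simp only [pow_zero, one_smul] at h
  simp only [chernAux_apply, H.toDual_smul, hol.leibniz, map_add, hermForm_lmul_right,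
    hermForm_tmk, contract_tmk, one_mul, X.conj_delbar, SetLike.GradeZero.coe_mul,
    StarCalculus.starB, h]
  noncomm_ring

theorem hermForm_lmul_left (b : 𝒜 0) (x y : Twisted 𝒜 F) :
    H.hermForm (lmul (b : Ω) x) y = b * H.hermForm x y := by
  refine tw_induction (P := fun y => H.hermForm (lmul (b : Ω) x) y = b * H.hermForm x y)
    (by simp) (fun y y' h h' => by simp only [map_add, h, h', mul_add]) (fun ω k => ?_) y
  rw [hermForm_tmk, hermForm_tmk, ← mul_assoc]
  congr 1
  refine tw_induction (P := fun x => H.contract k (lmul (b : Ω) x) = b * H.contract k x)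
    (by simp) (fun y y' h h' => by simp only [map_add, h, h', mul_add]) (fun η f => ?_) x
  rw [lmul_tmk, contract_tmk, contract_tmk, mul_assoc]

theorem chernAux_smul_right (b : 𝒜 0) (k f : F) :
    H.chernAux hol k (b • f) = X.del b * (H.toDual k f : 𝒜 0) + b * H.chernAux hol k f := by
  have h := X.del_derivation 0 _ b.2 (H.toDual k f : 𝒜 0)
  simp only [pow_zero, one_smul] at h
  have h2 : tmk 𝒜 (1 : Ω) (b • f) = lmul (b : Ω) (tmk 𝒜 1 f) := by
    rw [lmul_tmk, ← tmk_bal, one_mul, mul_one]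
  simp only [chernAux_apply, h2, hermForm_lmul_left, map_smul, smul_eq_mul,
    SetLike.GradeZero.coe_mul, h]
  noncomm_ring

theorem formsIn_mono {W W' : Submodule ℂ Ω} (h : W ≤ W') :
    formsIn (𝒜 := 𝒜) F W ≤ formsIn F W' :=
  Submodule.span_mono (by rintro _ ⟨ω, hω, f, rfl⟩; exact ⟨ω, h hω, f, rfl⟩)

theorem projF_same (p : ℕ × ℕ) {x : Twisted 𝒜 F} (hx : x ∈ formsIn F (𝒷 p)) :
    projF X p x = x := by
  refine Submodule.span_induction (p := fun x _ => projF X p x = x)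
    ?_ (by simp) (fun x y _ _ h h' => by rw [map_add, h, h'])
    (fun c x _ h => by rw [map_smul, h]) hx
  rintro _ ⟨ω, hω, k, rfl⟩
  rw [projF, mapLeft_tmk, GradedAlgebra.proj_apply, DirectSum.decompose_of_mem_same 𝒷 hω]

/-- A finitely generated projective Hermitian module has a finite basis `e` and dual basis of the
form `h_F(-, u i)`. -/
theorem exists_dual_basis [Module.Finite (𝒜 0) F] [Module.Projective (𝒜 0) F] :
    ∃ (m : ℕ) (e u : Fin m → F), ∀ f, f = ∑ i, H.toDual (u i) f • e i := by
  obtain ⟨m, p, s, -, -, hps⟩ := Module.Finite.exists_comp_eq_id_of_projective (𝒜 0) F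
  choose u hu using fun i => H.bijective.2 ((LinearMap.proj i).comp s)
  refine ⟨m, fun i => p (Pi.single i 1), u, fun f => ?_⟩
  have h1 : f = p (s f) := (LinearMap.congr_fun hps f).symm
  have h2 : s f = ∑ i, s f i • (Pi.single i 1 : Fin m → 𝒜 0) := by
    ext j; simp [Finset.sum_apply, Pi.single_apply]
  conv_lhs => rw [h1, h2, map_sum]
  exact Finset.sum_congr rfl fun i _ => by rw [map_smul, hu]; rfl

theorem toDual_zero : H.toDual 0 = 0 := LinearMap.ext fun f => by
  have h := LinearMap.congr_fun (H.toDual_add 0 0) f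
  rw [add_zero] at h
  exact left_eq_add.1 h

theorem toDual_sum {m : ℕ} (g : Fin m → F) : H.toDual (∑ i, g i) = ∑ i, H.toDual (g i) :=
  map_sum (⟨⟨H.toDual, H.toDual_zero⟩, H.toDual_add⟩ : F →+ (F →ₗ[𝒜 0] 𝒜 0)) g _

theorem exists_isChern [Module.Finite (𝒜 0) F] [Module.Projective (𝒜 0) F] :
    ∃ N : Connection 𝒜 F C.d (𝒜 1), H.IsChern hol N := by
  obtain ⟨m, e, u, he⟩ := H.exists_dual_basis
  have hu : ∀ k, k = ∑ i, H.toDual (e i) k • u i := by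
    intro k
    apply H.bijective.1
    ext f : 1
    rw [toDual_sum, LinearMap.sum_apply]
    simp only [H.toDual_smul, ← H.symm]
    conv_lhs => rw [he f, map_sum]
    simp
  have hφ : ∀ f k, ∑ i, H.chernAux hol (u i) f * (H.toDual k (e i) : 𝒜 0) =
      H.chernAux hol k f := by
    intro f k
    let A : F →+ Ω := ⟨⟨fun k => H.chernAux hol k f, by
      simpa using H.chernAux_add hol 0 0 f⟩, fun k k' => H.chernAux_add hol k k' f⟩
    have hA : ∀ k, A k = H.chernAux hol k f := fun _ => rfl
    rw [← hA]
    conv_rhs => rw [hu k, map_sum]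
    refine Finset.sum_congr rfl fun i _ => ?_
    rw [hA, chernAux_smul_left, H.symm_coe (e i) k]
  obtain ⟨D, hD⟩ : ∃ D : F →ₗ[ℂ] Twisted 𝒜 F,
      ∀ f, D f = ∑ i, tmk 𝒜 (H.chernAux hol (u i) f) (e i) :=
    ⟨∑ i, (tmk 𝒜).flip (e i) ∘ₗ H.chernAux hol (u i), fun f => by simp⟩
  have m10 : 𝒷 (1, 0) ≤ 𝒜 1 := fun x hx => X.mem_total hx
  have m01 : 𝒷 (0, 1) ≤ 𝒜 1 := fun x hx => X.mem_total hx
  have hDmem : ∀ f, D f ∈ formsIn F (𝒷 (1, 0)) := fun f => by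
    rw [hD]
    exact sum_mem fun i _ => Submodule.subset_span ⟨_, H.chernAux_mem hol _ _, _, rfl⟩
  have hDc : ∀ f k, H.contract k (D f) = H.chernAux hol k f := fun f k => by
    rw [hD, map_sum, ← hφ]; rfl
  refine ⟨⟨D + hol.map, fun f => ?_, fun b f => ?_⟩, fun f k => ?_, fun f => ?_⟩
  · exact add_mem (formsIn_mono m10 (hDmem f)) (formsIn_mono m01 (hol.mem f))
  · have h1 : D (b • f) = tmk 𝒜 (X.del b) f + lmul (b : Ω) (D f) := by
      have h2 : tmk 𝒜 (X.del b) f =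
          ∑ i, tmk 𝒜 (X.del b * (H.toDual (u i) f : 𝒜 0)) (e i) := by
        conv_lhs => rw [he f, map_sum]
        simp only [tmk_bal]
      rw [h2, hD, hD, map_sum, ← Finset.sum_add_distrib]
      refine Finset.sum_congr rfl fun i _ => ?_
      rw [chernAux_smul_right, map_add, LinearMap.add_apply, lmul_tmk]
    simp only [LinearMap.add_apply, h1, hol.leibniz, X.d_eq, map_add]
    abel
  · simp only [LinearMap.add_apply, map_add, hermForm_one_right, hDc, X.d_eq]
    have h1 : H.hermForm (tmk 𝒜 1 f) (D k) =
        X.delbar (H.toDual k f : 𝒜 0) - H.contract k (hol.map f) := by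
      rw [← conj_contract, hDc, chernAux_apply, map_sub, X.conj_del, ← symm_coe, ← conj_contract,
        C.conj_conj]
    rw [h1, chernAux_apply]
    abel
  · have h1 : projF X (0, 1) (D f) = 0 := by
      rw [hD, map_sum]
      refine Finset.sum_eq_zero fun i _ => ?_
      rw [projF, mapLeft_tmk, GradedAlgebra.proj_apply,
        DirectSum.decompose_of_mem_ne 𝒷 (H.chernAux_mem hol _ _) (by simp)]
      simp
    simp only [LinearMap.add_apply, map_add, h1, zero_add]
    exact (projF_same _ (hol.mem f)).symm

/-- The Chern connection of an Hermitian holomorphic module. -/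
def chern [Module.Finite (𝒜 0) F] [Module.Projective (𝒜 0) F] :
    Connection 𝒜 F C.d (𝒜 1) :=
  (H.exists_isChern hol).choose

end ChernExistence

end HermitianModule

end Modules

section Kahler

variable {Ω : Type*} [Ring Ω] [Algebra ℂ Ω] {𝒜 : ℕ → Submodule ℂ Ω} [GradedAlgebra 𝒜]
  {C : StarCalculus 𝒜} {𝒷 : ℕ × ℕ → Submodule ℂ Ω} [GradedAlgebra 𝒷]

/-- A Kähler structure of total degree `2n`: a closed central real `(1,1)`-form `κ` for which the
powers `L^{n-k} : Ω^k → Ω^{2n-k}` of the Lefschetz operator `L ω = κ ∧ ω` are isomorphisms. -/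
structure KahlerStructure (X : ComplexStructure C 𝒷) (n : ℕ) where
  /-- the Kähler form -/
  kappa : Ω
  totalDegree : HasTotalDegree 𝒜 (2 * n)
  mem : kappa ∈ 𝒷 (1, 1)
  real : C.conj kappa = kappa
  central : ∀ ω, kappa * ω = ω * kappa
  closed : C.d kappa = 0
  lefschetz : ∀ k, k < n → Set.BijOn (fun ω => kappa ^ (n - k) * ω) (𝒜 k) (𝒜 (2 * n - k))

variable (C) in
/-- A state on `B`. -/
structure State where
  /-- the underlying functional -/
  map : 𝒜 0 →ₗ[ℂ] ℂ
  pos : ∀ b : 𝒜 0, b ≠ 0 → (map (C.starB b * b)).im = 0 ∧ 0 < (map (C.starB b * b)).re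

variable {F : Type*} [AddCommGroup F] [Module ℂ F] [Module (𝒜 0) F] [IsScalarTower ℂ (𝒜 0) F]

variable {X : ComplexStructure C 𝒷}

/-- The operator `∂̄_F` on `Ω^• ⊗_B F`. -/
def delbarF (hol : HolomorphicStructure F X) : Twisted 𝒜 F →ₗ[ℂ] Twisted 𝒜 F :=
  hol.toConnection.ext X.delbar_derivation

/-- The operator `∂_F` on `Ω^• ⊗_B F`, the extension of the `(1,0)`-part of the Chern
connection. -/
def delF [Module.Finite (𝒜 0) F] [Module.Projective (𝒜 0) F] (H : HermitianModule F C)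
    (hol : HolomorphicStructure F X) : Twisted 𝒜 F →ₗ[ℂ] Twisted 𝒜 F :=
  (delPart X (H.chern hol)).ext X.del_derivation

variable (𝒜 𝒷 F) in
/-- The space `Ω^{(0,•)} ⊗_B F`. -/
def antiholForms : Submodule ℂ (Twisted 𝒜 F) := formsIn F (⨆ b, 𝒷 (0, b))

namespace KahlerStructure

variable {n : ℕ} (K : KahlerStructure X n)

/-- The Hodge map is the `B`-bimodule map determined by the Weil formula
`∗ (L^j α) = (-1)^{k(k+1)/2} i^{a-b} (j! / (n-j-k)!) L^{n-j-k} α` for `α ∈ Ω^{(a,b)}` primitive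
(that is, `k = a + b ≤ n` and `L^{n-k+1} α = 0`) and `j ≤ n - k`. -/
structure IsHodge (T : Ω →ₗ[ℂ] Ω) : Prop where
  left_mul : ∀ (b : 𝒜 0) (ω : Ω), T (b * ω) = b * T ω
  right_mul : ∀ (ω : Ω) (b : 𝒜 0), T (ω * b) = T ω * b
  weil : ∀ a b j, j + (a + b) ≤ n → ∀ α ∈ 𝒷 (a, b), K.kappa ^ (n - (a + b) + 1) * α = 0 →
    T (K.kappa ^ j * α) =
      ((-1 : ℂ) ^ ((a + b) * (a + b + 1) / 2) * Complex.I ^ ((a : ℤ) - (b : ℤ)) *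
        ((j.factorial : ℂ) / ((n - j - (a + b)).factorial : ℂ))) •
        (K.kappa ^ (n - j - (a + b)) * α)

open Classical in
/-- The Hodge map `∗` of the Kähler structure. -/
def hodge : Ω →ₗ[ℂ] Ω := if h : ∃ T, K.IsHodge T then h.choose else 0

theorem hodge_left_mul (b : 𝒜 0) (ω : Ω) : K.hodge (b * ω) = b * K.hodge ω := by
  unfold hodge
  split_ifs with h
  · exact h.choose_spec.left_mul b ω
  · simp

/-- The metric `g (ω, ν) = ∗ (ω ∧ ∗ (ν^*))` for forms of the same degree, and `g (ω, ν) = 0` for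
forms of different degrees. Since `∗ (ω ∧ ∗ (ν^*))` has degree `l - k` for `ω ∈ Ω^k`, `ν ∈ Ω^l`,
this is the degree zero component of `∗ (ω ∧ ∗ (ν^*))` in all cases. -/
def metric : Ω →ₗ[ℂ] Ω →ₛₗ[starRingEnd ℂ] 𝒜 0 :=
  LinearMap.mk₂'ₛₗ (RingHom.id ℂ) (starRingEnd ℂ)
    (fun ω ν => DirectSum.decompose 𝒜 (K.hodge (ω * K.hodge (C.conj ν))) 0)
    (fun _ _ _ => by simp [add_mul]) (fun _ _ _ => by simp [DirectSum.smul_apply])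
    (fun _ _ _ => by simp [mul_add]) (fun _ _ _ => by simp [DirectSum.smul_apply])

theorem metric_apply (ω ν : Ω) : K.metric ω ν =
    DirectSum.decompose 𝒜 (K.hodge (ω * K.hodge (C.conj ν))) 0 := rfl

/-- The metric is positive definite. -/
def PositiveDefinite : Prop := ∀ ω, ω ≠ 0 → C.IsPos (K.metric ω ω)

/-- The integral `∫ = f ∘ ∗ : Ω^{2n} → ℂ` is closed, that is, it vanishes on `d Ω^{2n-1}`. -/
def ClosedIntegral (s : State C) : Prop :=
  ∀ k, k + 1 = 2 * n → ∀ ω ∈ 𝒜 k, s.map (DirectSum.decompose 𝒜 (K.hodge (C.d ω)) 0) = 0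

/-- The Hermitian metric `g_F (ω ⊗ f, ν ⊗ k) = g (ω h_F(f, k), ν)` on `Ω^• ⊗_B F`. -/
def metricF (H : HermitianModule F C) :
    Twisted 𝒜 F →ₗ[ℂ] Twisted 𝒜 F →ₛₗ[starRingEnd ℂ] 𝒜 0 :=
  H.pairing K.metric (fun ω b ν => by
    have h := C.conj_mul_zero ν (C.starB b)
    simp only [StarCalculus.starB, C.conj_conj] at h
    rw [metric_apply, metric_apply, h, hodge_left_mul, mul_assoc])

/-- The pairing `⟨α, β⟩_F = f (g_F (α, β))`. -/
def innerF (H : HermitianModule F C) (s : State C) (α β : Twisted 𝒜 F) : ℂ :=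
  s.map (K.metricF H α β)

/-- `S` is adjoint to `T` with respect to `⟨·,·⟩_F`. -/
def IsAdjointF (H : HermitianModule F C) (s : State C) (T S : Twisted 𝒜 F →ₗ[ℂ] Twisted 𝒜 F) :
    Prop :=
  ∀ α β, K.innerF H s (T α) β = K.innerF H s α (S β)

open Classical in
/-- The adjoint `T^†` of an adjointable operator `T` on `Ω^• ⊗_B F`. -/
def dagger (H : HermitianModule F C) (s : State C) (T : Twisted 𝒜 F →ₗ[ℂ] Twisted 𝒜 F) :
    Twisted 𝒜 F →ₗ[ℂ] Twisted 𝒜 F :=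
  if h : ∃ S, K.IsAdjointF H s T S then h.choose else 0

/-- The Dolbeault–Dirac operator `D_{∂̄_F} = ∂̄_F + ∂̄_F^†`. -/
def dirac (H : HermitianModule F C) (s : State C) (hol : HolomorphicStructure F X) :
    Twisted 𝒜 F →ₗ[ℂ] Twisted 𝒜 F :=
  delbarF hol + K.dagger H s (delbarF hol)

/-- The Laplace operator `Δ_{∂̄_F} = D_{∂̄_F}^2`. -/
def laplacian (H : HermitianModule F C) (s : State C) (hol : HolomorphicStructure F X) :
    Twisted 𝒜 F →ₗ[ℂ] Twisted 𝒜 F :=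
  K.dirac H s hol ∘ₗ K.dirac H s hol

/-- `F` is negative with constant `θ`: the Chern connection satisfies `∇² f = θ i κ ⊗ f`. -/
def IsNegative [Module.Finite (𝒜 0) F] [Module.Projective (𝒜 0) F] (H : HermitianModule F C)
    (hol : HolomorphicStructure F X) (θ : ℝ) : Prop :=
  0 < θ ∧ ∀ f, (H.chern hol).curvature C.d_mul f = ((θ : ℂ) * Complex.I) • tmk 𝒜 K.kappa f

end KahlerStructure

end Kahler

end NCKahler

end

/-! On `Ω^{(0,b)} ⊗_B F` with `b < n` the Laplacian satisfies the Akizuki–Nakano identity `Δ = θ (n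
- b) + ∂_F^† ∂_F` (`laplace_identity`). For `b = n - 1` the constant is `θ`, so a form killed by
`∂_F` is an eigenvector with eigenvalue `θ`. Such a form `α` has `∂̄_F^† α = 0`, so `D` maps `α` to
`∂̄_F α` and `∂̄_F α` to `θ α`; hence `∂̄_F α + √θ α` is an eigenvector of `D` with eigenvalue `√θ`.
If the inner product is positive definite, then `∂_F^† ∂_F ≥ 0` and every eigenvalue in bidegree
`(0,b)`, `b < n`, is at least `θ (n - b) ≥ θ`. In bidegree `(0,n)` the Laplacian is `∂̄_F ∂̄_F^†`,
and `∂̄_F^†` carries an eigenvector with non-zero eigenvalue to one in bidegree `(0,n-1)`. The bound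
for `D` follows from `Δ = D²`.

The adjoints come from Stokes: the pairing is `∫ h_F(x, ∗y)` (`innerF_eq_integral`), the integrals
of `∂` and `∂̄` of any form vanish, and the Chern connection gives Leibniz rules for `h_F` in which
`∂̄_F` and `∂_F` are conjugate. Hence `∂̄_F^† = -∗ ∂_F ∗` and `∂_F^† = -∗ ∂̄_F ∗`
(`isAdjointF_of_leibniz`). Adjoints are unique because the pairing is non-degenerate
(`eq_zero_of_innerF`), which does not need it to be positive definite.

The identity itself avoids the general Kähler identities and the dual Lefschetz operator. Forms of
bidegree `(0,b)` are automatically primitive, so the Weil formula applies to them directly, and `∂_F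
x` has only two Lefschetz components, a primitive `(1,b)`-form and `κ` times a `(0,b-1)`-form.
Everything else is the equality `∂_F ∂̄_F + ∂̄_F ∂_F = θ i L` (`delF_delbarF`) and a comparison of
Weil coefficients. -/

noncomputable section

namespace NCKahler

/-! ### Lefschetz decomposition, vanishing by bidegree, and the Hodge map. -/

section Lefschetz

variable {Ω : Type*} [Ring Ω] [Algebra ℂ Ω] {𝒜 : ℕ → Submodule ℂ Ω} [GradedAlgebra 𝒜]
  {C : StarCalculus 𝒜} {𝒷 : ℕ × ℕ → Submodule ℂ Ω} [GradedAlgebra 𝒷]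
  {X : ComplexStructure C 𝒷}

theorem ComplexStructure.decompose_eq_zero (X : ComplexStructure C 𝒷) {m : ℕ} {ω : Ω}
    (hω : ω ∈ 𝒜 m) {p : ℕ × ℕ} (hp : p.1 + p.2 ≠ m) : (DirectSum.decompose 𝒷 ω p : Ω) = 0 := by
  rw [X.total] at hω
  refine Submodule.iSup_induction
    (motive := fun ω => (DirectSum.decompose 𝒷 ω p : Ω) = 0) _ hω ?_ (by simp)
    (fun x y hx hy => by simp [hx, hy])
  intro q x hx
  by_cases hq : q.1 + q.2 = m
  · simp only [hq, iSup_pos] at hx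
    exact DirectSum.decompose_of_mem_ne 𝒷 hx (by rintro rfl; exact hp hq)
  · simp only [hq, iSup_neg, not_false_eq_true, Submodule.mem_bot] at hx
    simp [hx]

namespace KahlerStructure

variable {n : ℕ} (K : KahlerStructure X n)

theorem eq_zero_of_degree_gt (K : KahlerStructure X n) {m : ℕ} (hm : 2 * n < m) {ω : Ω} (hω : ω ∈ 𝒜 m) : ω = 0 := by
  rw [K.totalDegree.2 m hm] at hω
  exact hω

theorem kappa_pow_mem (p : ℕ) : K.kappa ^ p ∈ 𝒷 (p, p) := by
  simpa using SetLike.pow_mem_graded p K.mem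

theorem kappa_pow_mem_total (p : ℕ) : K.kappa ^ p ∈ 𝒜 (2 * p) := by
  simpa [two_mul] using X.mem_total (K.kappa_pow_mem p)

theorem kappa_pow_central (p : ℕ) (ω : Ω) : K.kappa ^ p * ω = ω * K.kappa ^ p :=
  ((show Commute K.kappa ω from K.central ω).pow_left p).eq

theorem kappa_pow_mul_mem {p a b : ℕ} {ω : Ω} (hω : ω ∈ 𝒷 (a, b)) :
    K.kappa ^ p * ω ∈ 𝒷 (a + p, b + p) := by
  have := SetLike.mul_mem_graded (K.kappa_pow_mem p) hω
  rwa [Prod.mk_add_mk, add_comm p a, add_comm p b] at this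

theorem kappa_pow_mul_mem_total {p m : ℕ} {ω : Ω} (hω : ω ∈ 𝒜 m) :
    K.kappa ^ p * ω ∈ 𝒜 (m + 2 * p) := by
  have := SetLike.mul_mem_graded (K.kappa_pow_mem_total p) hω
  rwa [add_comm] at this

theorem decompose_kappa_pow_mul (p a b : ℕ) (ω : Ω) :
    (DirectSum.decompose 𝒷 (K.kappa ^ p * ω) (a + p, b + p) : Ω) =
      K.kappa ^ p * DirectSum.decompose 𝒷 ω (a, b) := by
  have := DirectSum.coe_decompose_mul_add_of_left_mem 𝒷 (j := (a, b)) (b := ω) (K.kappa_pow_mem p)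
  rwa [Prod.mk_add_mk, add_comm p a, add_comm p b] at this

/-- The span of the forms `κ^j α` of degree `m`, for `α` primitive of degree at most `n - j`. -/
def lefschetzSpan (m : ℕ) : Submodule ℂ Ω :=
  Submodule.span ℂ {x | ∃ a b j, j + (a + b) ≤ n ∧ 2 * j + (a + b) = m ∧ ∃ α ∈ 𝒷 (a, b),
    K.kappa ^ (n - (a + b) + 1) * α = 0 ∧ x = K.kappa ^ j * α}

theorem kappa_pow_mul_mem_lefschetzSpan (p : ℕ) {m : ℕ} {ω : Ω} (hω : ω ∈ K.lefschetzSpan m) :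
    K.kappa ^ p * ω ∈ K.lefschetzSpan (m + 2 * p) := by
  refine Submodule.span_induction
    (p := fun ω _ => K.kappa ^ p * ω ∈ K.lefschetzSpan (m + 2 * p)) ?_ (by simp)
    (fun x y _ _ hx hy => by rw [mul_add]; exact add_mem hx hy)
    (fun c x _ hx => by rw [mul_smul_comm]; exact Submodule.smul_mem _ _ hx) hω
  rintro _ ⟨a, b, j, h1, h2, α, hα, h0, rfl⟩
  rw [← mul_assoc, ← pow_add]
  by_cases h : p + j + (a + b) ≤ n
  · exact Submodule.subset_span ⟨a, b, p + j, h, by omega, α, hα, h0, rfl⟩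
  · obtain ⟨q, hq⟩ : ∃ q, p + j = q + (n - (a + b) + 1) := ⟨p + j - (n - (a + b) + 1), by omega⟩
    rw [hq, pow_add, mul_assoc, h0, mul_zero]
    exact zero_mem _

theorem mem_lefschetzSpan_of_primitive {m : ℕ} (hm : m ≤ n) {ω : Ω} (hω : ω ∈ 𝒜 m)
    (h0 : K.kappa ^ (n - m + 1) * ω = 0) : ω ∈ K.lefschetzSpan m := by
  classical
  rw [← DirectSum.sum_support_decompose 𝒷 ω]
  refine sum_mem fun p _ => ?_
  obtain ⟨a, b⟩ := p
  by_cases hab : a + b = m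
  · subst hab
    refine Submodule.subset_span ⟨a, b, 0, by omega, by omega, _, SetLike.coe_mem _, ?_,
      by rw [pow_zero, one_mul]⟩
    rw [← decompose_kappa_pow_mul, h0]
    simp
  · rw [X.decompose_eq_zero hω hab]
    exact zero_mem _

/-- The Lefschetz decomposition. -/
theorem mem_lefschetzSpan {m : ℕ} {ω : Ω} (hω : ω ∈ 𝒜 m) : ω ∈ K.lefschetzSpan m := by
  induction m using Nat.strong_induction_on generalizing ω with
  | _ m ih =>
  rcases le_or_gt m n with hm | hm
  · rcases lt_or_ge m 2 with h2 | h2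
    -- In degree `m ≤ 1` every form is primitive: `κ^{n-m+1} ω` has degree `2n - m + 2 > 2n`.
    · refine K.mem_lefschetzSpan_of_primitive hm hω ?_
      exact K.eq_zero_of_degree_gt (by omega) (K.kappa_pow_mul_mem_total hω)
    · obtain ⟨k, rfl⟩ := Nat.exists_eq_add_of_le' h2
      have h := (K.lefschetz k (by omega)).surjOn
      have h1 : K.kappa ^ (n - (k + 2) + 1) * ω ∈ 𝒜 (2 * n - k) := by
        have := K.kappa_pow_mul_mem_total (p := n - (k + 2) + 1) hω
        rwa [show k + 2 + 2 * (n - (k + 2) + 1) = 2 * n - k by omega] at this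
      -- With `m = k + 2`, the form `κ^{n-m+1} ω` lies in the image of the isomorphism `L^{n-k}`.
      -- Its preimage `η` is the correction that makes `ω - κ η` primitive.
      obtain ⟨η, hη, hηω⟩ := h h1
      have hη' := K.kappa_pow_mul_mem_lefschetzSpan 1 (ih k (by omega) hη)
      have h3 : ω - K.kappa ^ 1 * η ∈ K.lefschetzSpan (k + 2) := by
        refine K.mem_lefschetzSpan_of_primitive hm
          (sub_mem hω (K.kappa_pow_mul_mem_total (p := 1) hη)) ?_
        rw [mul_sub, ← hηω, ← mul_assoc, ← pow_add,
          show n - (k + 2) + 1 + 1 = n - k by omega, sub_self]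
      simpa using add_mem h3 hη'
  · rcases le_or_gt m (2 * n) with h2 | h2
    -- Above the middle degree, `ω` is a power of `κ` times a form of the complementary degree `2n -
    -- m < m`.
    · have h := (K.lefschetz (2 * n - m) (by omega)).surjOn
      rw [show 2 * n - (2 * n - m) = m by omega] at h
      obtain ⟨η, hη, rfl⟩ := h hω
      have h3 := K.kappa_pow_mul_mem_lefschetzSpan (n - (2 * n - m)) (ih _ (by omega) hη)
      rwa [show 2 * n - m + 2 * (n - (2 * n - m)) = m by omega] at h3
    · rw [K.eq_zero_of_degree_gt h2 hω]
      exact zero_mem _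

/-- Multiplication by `κ^p` shifts bidegrees by `(p,p)`, so the `(a,b)`-component of a Lefschetz
preimage is again a preimage. Dividing by powers of `κ` in this way replaces the dual Lefschetz
operator. -/
theorem exists_eq_kappa_pow_mul {a b p : ℕ} (h : a + b + p = n) {ω : Ω}
    (hω : ω ∈ 𝒷 (a + p, b + p)) : ∃ η ∈ 𝒷 (a, b), ω = K.kappa ^ p * η := by
  rcases Nat.eq_zero_or_pos p with rfl | hp
  · exact ⟨ω, hω, by simp⟩
  · have h1 := (K.lefschetz (a + b) (by omega)).surjOn
    have h2 := X.mem_total hω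
    rw [show a + p + (b + p) = 2 * n - (a + b) by omega] at h2
    obtain ⟨η, -, hη⟩ := h1 h2
    refine ⟨_, SetLike.coe_mem (DirectSum.decompose 𝒷 η (a, b)), ?_⟩
    rw [← decompose_kappa_pow_mul, show p = n - (a + b) by omega] at *
    simp only at hη
    rw [hη, DirectSum.decompose_of_mem_same 𝒷 hω]

/-- In total degree at most `2n` such a form is `κ^p η` with `p = a + b - n`. If `a > n` then `p >
b`, and if `b > n` then `p > a`; either way a multiple of `κ^p` has no component of bidegree
`(a,b)`. -/
theorem eq_zero_of_bidegree (K : KahlerStructure X n) {a b : ℕ} (h : n < a ∨ n < b) {ω : Ω} (hω : ω ∈ 𝒷 (a, b)) :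
    ω = 0 := by
  have h2 := X.mem_total hω
  rcases lt_or_ge (2 * n) (a + b) with hab | hab
  · exact K.eq_zero_of_degree_gt hab h2
  · have h1 := (K.lefschetz (2 * n - (a + b)) (by omega)).surjOn
    rw [show 2 * n - (2 * n - (a + b)) = a + b by omega] at h1
    obtain ⟨η, -, rfl⟩ := h1 h2
    have := DirectSum.coe_decompose_mul_of_left_mem_of_not_le 𝒷 (b := η) (n := (a, b))
      (K.kappa_pow_mem (n - (2 * n - (a + b)))) (by rw [Prod.mk_le_mk]; omega)
    rw [← this]
    exact (DirectSum.decompose_of_mem_same 𝒷 hω).symm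

theorem bidegree_top (K : KahlerStructure X n) {η : Ω} {a b : ℕ} (hab : a + b = 2 * n) (h : (a, b) ≠ (n, n))
    (hη : η ∈ 𝒷 (a, b)) : η = 0 := by
  refine K.eq_zero_of_bidegree ?_ hη
  by_contra h'
  exact h (by ext <;> simp <;> omega)

/-- The product has bidegree `(n-k+1, n+1)`. Thus the Weil formula holds for all forms of type
`(0,k)`, `k ≤ n`. -/
theorem primitive_zero {k : ℕ} (hk : k ≤ n) {ω : Ω} (hω : ω ∈ 𝒷 (0, k)) :
    K.kappa ^ (n - (0 + k) + 1) * ω = 0 :=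
  K.eq_zero_of_bidegree (Or.inr (by omega)) (K.kappa_pow_mul_mem hω)

/-! ### The Hodge map -/

variable {K} in
-- `hodge` has the default value `0` if no Hodge map exists. The metric would then vanish
-- identically, which positive definiteness forbids because `Ω^{2n} ≠ 0`.
theorem isHodge (hK : K.PositiveDefinite) : K.IsHodge K.hodge := by
  by_cases h : ∃ T, K.IsHodge T
  · rw [hodge, dif_pos h]
    exact h.choose_spec
  · exfalso
    refine K.totalDegree.1 (eq_bot_iff.2 fun ω _ => ?_)
    by_contra hω
    refine (hK ω hω).2 ?_
    rw [metric_apply, hodge, dif_neg h]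
    simp

variable {K}

theorem hodge_right_mul (hK : K.PositiveDefinite) (ω : Ω) (b : 𝒜 0) :
    K.hodge (ω * b) = K.hodge ω * b :=
  (isHodge hK).right_mul ω b

/-- To prove an additive property of forms of degree `m`, it suffices to prove it for forms
`κ^j α`, with `α` primitive. -/
theorem lefschetz_induction (K : KahlerStructure X n) {m : ℕ} {P : Ω → Prop} (h0 : P 0)
    (hadd : ∀ x y, P x → P y → P (x + y))
    (hsmul : ∀ (c : ℂ) x, P x → P (c • x))
    (h : ∀ a b j l, j + (a + b) + l = n → 2 * j + (a + b) = m → ∀ α ∈ 𝒷 (a, b),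
      K.kappa ^ (n - (a + b) + 1) * α = 0 → P (K.kappa ^ j * α)) {ω : Ω} (hω : ω ∈ 𝒜 m) : P ω := by
  refine Submodule.span_induction (p := fun ω _ => P ω) ?_ h0 (fun x y _ _ => hadd x y)
    (fun c x _ => hsmul c x) (K.mem_lefschetzSpan hω)
  rintro _ ⟨a, b, j, h1, h2, α, hα, hp, rfl⟩
  exact h a b j _ (Nat.add_sub_cancel' h1) h2 α hα hp

theorem hodge_kappa_pow_mul (hK : K.PositiveDefinite) {a b j l : ℕ} (h : j + (a + b) + l = n)
    {α : Ω} (hα : α ∈ 𝒷 (a, b)) (h0 : K.kappa ^ (n - (a + b) + 1) * α = 0) :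
    K.hodge (K.kappa ^ j * α) = ((-1 : ℂ) ^ ((a + b) * (a + b + 1) / 2) *
      Complex.I ^ ((a : ℤ) - (b : ℤ)) * ((j.factorial : ℂ) / (l.factorial : ℂ))) •
        (K.kappa ^ l * α) := by
  rw [(isHodge hK).weil a b j (by omega) α hα h0, show n - j - (a + b) = l by omega]

theorem weil_sign_sq (a b : ℕ) :
    ((-1 : ℂ) ^ ((a + b) * (a + b + 1) / 2) * Complex.I ^ ((a : ℤ) - (b : ℤ))) *
    ((-1 : ℂ) ^ ((a + b) * (a + b + 1) / 2) * Complex.I ^ ((a : ℤ) - (b : ℤ))) =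
      (-1) ^ (a + b) := by
  rw [mul_mul_mul_comm, ← mul_pow, ← zpow_add₀ Complex.I_ne_zero, ← two_mul, zpow_mul,
    zpow_ofNat, Complex.I_sq, zpow_sub₀ (by norm_num), zpow_natCast, zpow_natCast, neg_one_mul,
    neg_neg, one_pow, one_mul, pow_add, div_eq_mul_inv, ← inv_pow]
  norm_num

/-- For `α` primitive, `∗` exchanges the lines of `κ^j α` and `κ^l α`. The factors `j!/l!` and
`l!/j!` cancel, and the square of the remaining sign is `(-1)^{a+b} = (-1)^m`. -/
theorem hodge_hodge (hK : K.PositiveDefinite) {m : ℕ} {ω : Ω} (hω : ω ∈ 𝒜 m) :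
    K.hodge (K.hodge ω) = (-1 : ℂ) ^ m • ω := by
  refine lefschetz_induction K (P := fun ω => K.hodge (K.hodge ω) = (-1 : ℂ) ^ m • ω) (by simp)
    (fun x y hx hy => by simp only [map_add, hx, hy, smul_add])
    (fun c x hx => by simp only [map_smul, hx]; rw [smul_comm]) ?_ hω
  intro a b j l h hm α hα h0
  rw [hodge_kappa_pow_mul hK h hα h0, map_smul,
    hodge_kappa_pow_mul hK (j := l) (l := j) (by omega) hα h0, smul_smul, mul_mul_mul_comm,
    weil_sign_sq, div_mul_div_comm, mul_comm (l.factorial : ℂ), div_self, mul_one, ← hm,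
    pow_add _ (2 * j), pow_mul, neg_one_sq, one_pow, one_mul]
  · exact mul_ne_zero (by exact_mod_cast j.factorial_ne_zero)
      (by exact_mod_cast l.factorial_ne_zero)

/-- `∗` maps degree `m` to degree `2n - m`; consequently the integral sees only top forms. -/
theorem decompose_hodge_eq_zero (hK : K.PositiveDefinite) {m : ℕ} (hm : m ≠ 2 * n) {ω : Ω}
    (hω : ω ∈ 𝒜 m) : (DirectSum.decompose 𝒜 (K.hodge ω) 0 : 𝒜 0) = 0 := by
  refine lefschetz_induction K
    (P := fun ω => (DirectSum.decompose 𝒜 (K.hodge ω) 0 : 𝒜 0) = 0) (by simp)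
    (fun x y hx hy => by simp [hx, hy]) (fun c x hx => by simp [hx, DirectSum.smul_apply]) ?_ hω
  intro a b j l h hm α hα h0
  rw [hodge_kappa_pow_mul hK h hα h0, DirectSum.decompose_smul, DirectSum.smul_apply]
  have h1 := K.kappa_pow_mul_mem_total (p := l) (X.mem_total hα)
  have h2 : DirectSum.decompose 𝒜 (K.kappa ^ l * α) 0 = 0 :=
    Subtype.ext (DirectSum.decompose_of_mem_ne 𝒜 h1 (by omega))
  rw [h2, smul_zero]

theorem conj_kappa_pow_mul (K : KahlerStructure X n) (j : ℕ) {m : ℕ} {α : Ω} (hα : α ∈ 𝒜 m) :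
    C.conj (K.kappa ^ j * α) = K.kappa ^ j * C.conj α := by
  induction j with
  | zero => simp
  | succ j ih =>
    rw [pow_succ', mul_assoc, C.conj_mul 2 _ _ (X.mem_total K.mem) _
      (K.kappa_pow_mul_mem_total hα), pow_mul, neg_one_sq, one_pow, one_smul, ih, K.real, mul_assoc,
      ← K.central, K.kappa_pow_central, mul_assoc, ← K.kappa_pow_central, ← mul_assoc]

/-- As `κ` is real, conjugation takes primitive `(a,b)`-forms to primitive `(b,a)`-forms, and the
Weil coefficients of the two types are complex conjugate. -/
theorem conj_hodge (hK : K.PositiveDefinite) (ω : Ω) :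
    C.conj (K.hodge ω) = K.hodge (C.conj ω) := by
  refine hom_induction 𝒜 (P := fun ω => C.conj (K.hodge ω) = K.hodge (C.conj ω)) (by simp)
    (fun x y hx hy => by simp only [map_add, hx, hy]) (fun m ω hω => ?_) ω
  refine lefschetz_induction K (P := fun ω => C.conj (K.hodge ω) = K.hodge (C.conj ω)) (by simp)
    (fun x y hx hy => by simp only [map_add, hx, hy])
    (fun c x hx => by simp only [map_smul, map_smulₛₗ, hx]) ?_ hω
  intro a b j l h hm α hα h0
  have hα' := X.mem_total hα
  have h0' : K.kappa ^ (n - (b + a) + 1) * C.conj α = 0 := by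
    rw [← conj_kappa_pow_mul K _ hα', add_comm b a, h0, map_zero]
  rw [hodge_kappa_pow_mul hK h hα h0, map_smulₛₗ, conj_kappa_pow_mul K _ hα',
    conj_kappa_pow_mul K _ hα',
    hodge_kappa_pow_mul hK (by omega : j + (b + a) + l = n) (X.conj_mem _ _ _ hα) h0']
  congr 1
  simp only [map_mul, map_pow, map_zpow₀, map_div₀, map_natCast, map_neg, map_one, Complex.conj_I,
    add_comm b a]
  rw [← neg_sub (a : ℤ), zpow_neg, ← inv_zpow, Complex.inv_I]

end KahlerStructure

end Lefschetz

/-! ### Hermitian symmetry, non-degeneracy, and the pairing as an integral. -/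

section InnerProduct

variable {Ω : Type*} [Ring Ω] [Algebra ℂ Ω] {𝒜 : ℕ → Submodule ℂ Ω} [GradedAlgebra 𝒜]
  {C : StarCalculus 𝒜}

namespace StarCalculus

theorem starB_starB_mul_self (b : 𝒜 0) : C.starB (C.starB b * b) = C.starB b * b := by
  apply Subtype.ext
  change C.conj ((C.conj b : Ω) * b) = C.conj b * b
  rw [C.conj_mul_zero, C.conj_conj]

theorem starB_of_mem_nonnegCone {x : 𝒜 0} (hx : x ∈ C.nonnegCone) : C.starB x = x := by
  refine AddSubmonoid.closure_induction (motive := fun x _ => C.starB x = x) ?_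
    (Subtype.ext (by simp [StarCalculus.starB])) (fun x y _ _ hx hy => ?_) hx
  · rintro _ ⟨b, rfl⟩
    exact starB_starB_mul_self b
  · have : C.starB (x + y) = C.starB x + C.starB y := Subtype.ext (map_add C.conj (x : Ω) y)
    rw [this, hx, hy]

end StarCalculus

namespace State

variable (s : State C)

theorem map_of_mem_nonnegCone {x : 𝒜 0} (hx : x ∈ C.nonnegCone) :
    (s.map x).im = 0 ∧ 0 ≤ (s.map x).re ∧ (x ≠ 0 → 0 < (s.map x).re) := by
  refine AddSubmonoid.closure_induction
    (motive := fun x _ => (s.map x).im = 0 ∧ 0 ≤ (s.map x).re ∧ (x ≠ 0 → 0 < (s.map x).re))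
    ?_ (by simp) (fun x y _ _ hx hy => ?_) hx
  · rintro _ ⟨b, rfl⟩
    rcases eq_or_ne b 0 with rfl | hb
    · simp
    · exact ⟨(s.pos b hb).1, (s.pos b hb).2.le, fun _ => (s.pos b hb).2⟩
  · obtain ⟨h1, h2, h3⟩ := hx
    obtain ⟨k1, k2, k3⟩ := hy
    rw [map_add, Complex.add_im, Complex.add_re]
    refine ⟨by rw [h1, k1, add_zero], add_nonneg h2 k2, fun hxy => ?_⟩
    by_cases hx0 : x = 0
    · subst hx0
      exact add_pos_of_nonneg_of_pos h2 (k3 (by simpa using hxy))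
    · exact add_pos_of_pos_of_nonneg (h3 hx0) k2

theorem im_map_starB_mul_self (b : 𝒜 0) : (s.map (C.starB b * b)).im = 0 :=
  (s.map_of_mem_nonnegCone (AddSubmonoid.subset_closure ⟨b, rfl⟩)).1

/-- Polarisation: the state is real on `(1 + c b)^* (1 + c b)`. Taking `c = 1` compares imaginary
parts and `c = i` compares real parts. -/
theorem map_starB (b : 𝒜 0) : s.map (C.starB b) = starRingEnd ℂ (s.map b) := by
  have key : ∀ c : ℂ, (s.map (starRingEnd ℂ c • C.starB b) + s.map (c • b)).im = 0 := by
    intro c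
    have h := s.im_map_starB_mul_self (1 + c • b)
    have e : C.starB (1 + c • b) * (1 + c • b) = C.starB 1 * 1 + starRingEnd ℂ c • C.starB b +
        c • b + C.starB (c • b) * (c • b) := by
      apply Subtype.ext
      simp only [StarCalculus.starB, SetLike.GradeZero.coe_mul, Submodule.coe_add,
        SetLike.GradeZero.coe_one, Submodule.coe_smul, map_add, map_smulₛₗ, C.conj_one, mul_add,
        add_mul, one_mul, mul_one]
      abel
    rw [e, map_add, map_add, map_add, Complex.add_im, Complex.add_im, Complex.add_im,
      s.im_map_starB_mul_self, s.im_map_starB_mul_self] at h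
    rw [Complex.add_im]
    linarith
  have h1 := key 1
  have h2 := key Complex.I
  simp only [map_one, one_smul, map_smul, Complex.conj_I, smul_eq_mul, Complex.add_im,
    Complex.mul_im, Complex.neg_re, Complex.neg_im, Complex.I_re, Complex.I_im] at h1 h2
  apply Complex.ext
  · rw [Complex.conj_re]; linarith
  · rw [Complex.conj_im]; linarith

end State

variable {𝒷 : ℕ × ℕ → Submodule ℂ Ω} [GradedAlgebra 𝒷] {X : ComplexStructure C 𝒷}
  {F : Type*} [AddCommGroup F] [Module ℂ F] [Module (𝒜 0) F] [IsScalarTower ℂ (𝒜 0) F]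

namespace KahlerStructure

variable {n : ℕ} {K : KahlerStructure X n}

/-- Elements of the cone are self-adjoint, so `g(η, η)` is. Polarising with `ω + ν` and `ω + i ν`
gives the symmetry. -/
theorem conj_metric (hK : K.PositiveDefinite) (ω ν : Ω) :
    C.conj (K.metric ω ν) = K.metric ν ω := by
  have key : ∀ η, C.conj (K.metric η η) = K.metric η η := fun η => by
    rcases eq_or_ne η 0 with rfl | hη
    · simp
    · exact congrArg Subtype.val (C.starB_of_mem_nonnegCone (hK η hη).1)
  have h1 := key (ω + ν)
  have h2 := key (ω + Complex.I • ν)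
  simp only [map_add, LinearMap.add_apply, map_smul, map_smulₛₗ, LinearMap.smul_apply,
    Submodule.coe_add, Submodule.coe_smul, key, Complex.conj_I, neg_neg,
    neg_smul, map_neg, Submodule.coe_neg] at h1 h2
  have e1 : C.conj (K.metric ω ν) + C.conj (K.metric ν ω) =
      (K.metric ω ν : Ω) + K.metric ν ω := by
    have := sub_eq_zero.2 h1
    rw [← sub_eq_zero, ← this]; abel
  have e2 : Complex.I • (C.conj (K.metric ω ν) - C.conj (K.metric ν ω) +
      ((K.metric ω ν : Ω) - K.metric ν ω)) = 0 := by
    have := sub_eq_zero.2 h2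
    rw [← this]; simp only [smul_add, smul_sub, smul_neg]; abel
  have e3 := (smul_eq_zero.1 e2).resolve_left Complex.I_ne_zero
  have e4 : (2 : ℂ) • (C.conj (K.metric ω ν) - (K.metric ν ω : Ω)) = 0 := by
    rw [← sub_eq_zero] at e1
    rw [two_smul]
    calc _ = (C.conj (K.metric ω ν) + C.conj (K.metric ν ω) -
        ((K.metric ω ν : Ω) + K.metric ν ω)) + (C.conj (K.metric ω ν) - C.conj (K.metric ν ω) +
      ((K.metric ω ν : Ω) - K.metric ν ω)) := by abel
      _ = 0 := by rw [e1, e3, add_zero]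
  exact sub_eq_zero.1 ((smul_eq_zero.1 e4).resolve_left two_ne_zero)

theorem metric_mul_right (ω : Ω) (b : 𝒜 0) (ν : Ω) :
    K.metric (ω * b) ν = K.metric ω (ν * C.conj b) := by
  have h := C.conj_mul_zero ν (C.starB b)
  simp only [StarCalculus.starB, C.conj_conj] at h
  rw [metric_apply, metric_apply, h, hodge_left_mul, mul_assoc]

theorem metricF_tmk (H : HermitianModule F C) (x : Twisted 𝒜 F) (ν : Ω) (k : F) :
    K.metricF H x (tmk 𝒜 ν k) = K.metric (H.contract k x) ν := rfl

theorem conj_metricF (hK : K.PositiveDefinite) (H : HermitianModule F C) (x y : Twisted 𝒜 F) :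
    C.starB (K.metricF H x y) = K.metricF H y x := by
  apply Subtype.ext
  change C.conj (K.metricF H x y) = K.metricF H y x
  refine tw_induction (P := fun x => C.conj (K.metricF H x y) = K.metricF H y x) (by simp)
    (fun x x' h h' => by simp only [map_add, LinearMap.add_apply, Submodule.coe_add, h, h'])
    (fun ω f => ?_) x
  refine tw_induction (P := fun y => C.conj (K.metricF H (tmk 𝒜 ω f) y) =
      K.metricF H y (tmk 𝒜 ω f)) (by simp)
    (fun x x' h h' => by simp only [map_add, LinearMap.add_apply, Submodule.coe_add, h, h'])
    (fun ν k => ?_) y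
  rw [metricF_tmk, metricF_tmk, conj_metric hK, HermitianModule.contract_tmk,
    HermitianModule.contract_tmk, metric_mul_right, ← H.symm_coe]

section InnerF

variable (K) (H : HermitianModule F C) (s : State C)

theorem innerF_add_left (x x' y : Twisted 𝒜 F) :
    K.innerF H s (x + x') y = K.innerF H s x y + K.innerF H s x' y := by
  simp only [innerF, map_add, LinearMap.add_apply]

theorem innerF_add_right (x y y' : Twisted 𝒜 F) :
    K.innerF H s x (y + y') = K.innerF H s x y + K.innerF H s x y' := by
  simp only [innerF, map_add]

theorem innerF_smul_left (c : ℂ) (x y : Twisted 𝒜 F) :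
    K.innerF H s (c • x) y = c * K.innerF H s x y := by
  simp only [innerF, map_smul, LinearMap.smul_apply, smul_eq_mul]

theorem innerF_zero_left (x : Twisted 𝒜 F) : K.innerF H s 0 x = 0 := by
  simp only [innerF, map_zero, LinearMap.zero_apply]

theorem innerF_sub_right (x y y' : Twisted 𝒜 F) :
    K.innerF H s x (y - y') = K.innerF H s x y - K.innerF H s x y' := by
  simp only [innerF, map_sub]

variable {K}

theorem conj_innerF (hK : K.PositiveDefinite) (x y : Twisted 𝒜 F) :
    starRingEnd ℂ (K.innerF H s x y) = K.innerF H s y x := by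
  rw [innerF, ← s.map_starB, conj_metricF hK]
  rfl

/-- The pairing `⟨·,·⟩_F` is non-degenerate. -/
theorem eq_zero_of_innerF [Module.Finite (𝒜 0) F] [Module.Projective (𝒜 0) F]
    (hK : K.PositiveDefinite) {y : Twisted 𝒜 F} (hy : ∀ x, K.innerF H s x y = 0) : y = 0 := by
  -- Pairing `y` with the test form `(contract k y) ⊗ k` gives the state of `g(ω, ω)` for `ω =
  -- contract k y`, which is positive unless `ω = 0`.
  have hc : ∀ k, H.contract k y = 0 := by
    intro k
    by_contra h
    have h1 := hK _ h
    have h2 := (s.map_of_mem_nonnegCone h1.1).2.2 h1.2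
    have h3 := hy (tmk 𝒜 (H.contract k y) k)
    rw [← conj_innerF H s hK, innerF, metricF_tmk, map_eq_zero] at h3
    rw [h3] at h2
    simp at h2
  -- A dual basis recovers `y` from its contractions.
  obtain ⟨m, e, u, he⟩ := H.exists_dual_basis
  have h : ∀ y, y = ∑ i, tmk 𝒜 (H.contract (u i) y) (e i) := fun y => by
    refine tw_induction (P := fun y => y = ∑ i, tmk 𝒜 (H.contract (u i) y) (e i)) (by simp)
      (fun x x' h h' => ?_) (fun ω f => ?_) y
    · simp only [map_add, LinearMap.add_apply, Finset.sum_add_distrib, ← h, ← h']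
    · simp only [HermitianModule.contract_tmk, tmk_bal]
      rw [← map_sum, ← he]
  rw [h y]
  simp [hc]

end InnerF

/-! ### The integral -/

variable (K) in
/-- The integral `∫ = f ∘ ∗`, extended by zero to forms of degree less than `2n`. -/
def integral (s : State C) : Ω →ₗ[ℂ] ℂ :=
  s.map ∘ₗ DirectSum.component ℂ ℕ (fun i => 𝒜 i) 0 ∘ₗ
    (DirectSum.decomposeLinearEquiv 𝒜).toLinearMap ∘ₗ K.hodge

theorem integral_apply (s : State C) (ω : Ω) :
    K.integral s ω = s.map (DirectSum.decompose 𝒜 (K.hodge ω) 0) := rfl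

theorem integral_eq_zero (hK : K.PositiveDefinite) (s : State C) {m : ℕ} (hm : m ≠ 2 * n) {ω : Ω}
    (hω : ω ∈ 𝒜 m) : K.integral s ω = 0 := by
  rw [integral_apply, decompose_hodge_eq_zero hK hm hω, map_zero]

/-- The integral of `d ω` vanishes, and top forms all have bidegree `(n,n)`. For `ω` bihomogeneous
of degree `2n - 1`, one of `∂ ω` and `∂̄ ω` has the wrong bidegree and is zero, so the other has
integral zero. -/
theorem integral_del_and_delbar (hK : K.PositiveDefinite) {s : State C} (hs : K.ClosedIntegral s)
    (ω : Ω) : K.integral s (X.del ω) = 0 ∧ K.integral s (X.delbar ω) = 0 := by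
  refine hom_induction 𝒷
    (P := fun ω => K.integral s (X.del ω) = 0 ∧ K.integral s (X.delbar ω) = 0) (by simp)
    (fun x y hx hy => by simp only [map_add, hx, hy, add_zero, and_self]) ?_ ω
  rintro ⟨a, b⟩ ω hω
  have h1 := X.del_mem _ _ _ hω
  have h2 := X.delbar_mem _ _ _ hω
  by_cases hab : a + b + 1 = 2 * n
  · have h3 : K.integral s (X.del ω) + K.integral s (X.delbar ω) = 0 := by
      rw [← map_add, ← LinearMap.add_apply, ← X.d_eq]
      exact hs _ hab ω (X.mem_total hω)
    rcases eq_or_ne a n with rfl | ha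
    · have h4 : X.del ω = 0 := K.eq_zero_of_bidegree (by omega) h1
      rw [h4, map_zero, zero_add] at h3
      exact ⟨by rw [h4, map_zero], h3⟩
    · have h4 : X.delbar ω = 0 := K.bidegree_top (by omega) (by simp [ha]) h2
      rw [h4, map_zero, add_zero] at h3
      exact ⟨h3, by rw [h4, map_zero]⟩
  · exact ⟨integral_eq_zero hK s (by omega) (X.mem_total h1),
      integral_eq_zero hK s (by omega) (X.mem_total h2)⟩

/-- The Hodge map `∗ ⊗ id` on `Ω^• ⊗_B F`. -/
def hodgeF (F : Type*) [AddCommGroup F] [Module ℂ F] [Module (𝒜 0) F]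
    (hK : K.PositiveDefinite) : Twisted 𝒜 F →ₗ[ℂ] Twisted 𝒜 F :=
  mapLeft K.hodge (hodge_right_mul hK)

theorem hodgeF_tmk (hK : K.PositiveDefinite) (ω : Ω) (f : F) :
    hodgeF F hK (tmk 𝒜 ω f) = tmk 𝒜 (K.hodge ω) f := rfl

/-- This turns the computation of adjoints into integration by parts. -/
theorem innerF_eq_integral (hK : K.PositiveDefinite) (H : HermitianModule F C) (s : State C)
    (x y : Twisted 𝒜 F) : K.innerF H s x y = K.integral s (H.hermForm x (hodgeF F hK y)) := by
  refine tw_induction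
    (P := fun y => K.innerF H s x y = K.integral s (H.hermForm x (hodgeF F hK y)))
    (by simp [innerF]) (fun y y' h h' => ?_) (fun ν k => ?_) y
  · rw [innerF_add_right, h, h', map_add, map_add, map_add]
  · rw [innerF, metricF_tmk, hodgeF_tmk, HermitianModule.hermForm_tmk, conj_hodge hK]
    rfl

end KahlerStructure

end InnerProduct

/-! ### Leibniz rules and curvature for connections on twisted forms. -/

section TwistedForms

variable {Ω : Type*} [Ring Ω] [Algebra ℂ Ω] {𝒜 : ℕ → Submodule ℂ Ω} [GradedAlgebra 𝒜]
  {F : Type*} [AddCommGroup F] [Module ℂ F] [Module (𝒜 0) F]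

theorem tmk_mem_formsIn {W : Submodule ℂ Ω} {ω : Ω} (hω : ω ∈ W) (f : F) :
    tmk 𝒜 ω f ∈ formsIn F W :=
  Submodule.subset_span ⟨ω, hω, f, rfl⟩

/-- No hypothesis on scalars is needed, since a scalar can be absorbed into `ω ∈ W`. -/
theorem formsIn_induction {W : Submodule ℂ Ω} {P : Twisted 𝒜 F → Prop} (h0 : P 0)
    (hadd : ∀ x y, P x → P y → P (x + y)) (h : ∀ ω ∈ W, ∀ f, P (tmk 𝒜 ω f)) {x : Twisted 𝒜 F}
    (hx : x ∈ formsIn F W) : P x := by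
  suffices h' : ∀ c : ℂ, P (c • x) by simpa using h' 1
  refine Submodule.span_induction (p := fun x _ => ∀ c : ℂ, P (c • x)) ?_
    (fun c => by simpa using h0) (fun x y _ _ hx hy c => by rw [smul_add]; exact hadd _ _ (hx c) (hy c))
    (fun c x _ hx c' => by rw [smul_smul]; exact hx _) hx
  rintro _ ⟨ω, hω, f, rfl⟩ c
  have : c • tmk 𝒜 ω f = tmk 𝒜 (c • ω) f := by simp
  rw [this]
  exact h _ (W.smul_mem c hω) f

theorem formsIn_bot {W : Submodule ℂ Ω} (hW : ∀ ω ∈ W, ω = 0) {x : Twisted 𝒜 F}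
    (hx : x ∈ formsIn F W) : x = 0 :=
  formsIn_induction (P := fun x => x = 0) rfl (fun x y hx hy => by rw [hx, hy, add_zero])
    (fun ω hω f => by rw [hW ω hω]; simp) hx

theorem lmul_mem_formsIn {η : Ω} {W W' : Submodule ℂ Ω} (h : ∀ ω ∈ W, η * ω ∈ W')
    {x : Twisted 𝒜 F} (hx : x ∈ formsIn F W) : lmul η x ∈ formsIn F W' := by
  refine formsIn_induction (P := fun x => lmul η x ∈ formsIn F W') (by simp)
    (fun x y hx hy => by rw [map_add]; exact add_mem hx hy) (fun ω hω f => ?_) hx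
  rw [lmul_tmk]
  exact tmk_mem_formsIn (h ω hω) f

theorem lmul_one (x : Twisted 𝒜 F) : lmul (1 : Ω) x = x := by
  refine tw_induction (P := fun x => lmul (1 : Ω) x = x) (by simp)
    (fun x y hx hy => by rw [map_add, hx, hy]) (fun ω f => ?_) x
  rw [lmul_tmk, one_mul]

theorem formsIn_hom_induction {ι : Type*} [DecidableEq ι] [AddMonoid ι]
    (𝒢 : ι → Submodule ℂ Ω) [GradedAlgebra 𝒢] {P : Twisted 𝒜 F → Prop} (h0 : P 0)
    (hadd : ∀ x y, P x → P y → P (x + y)) (h : ∀ i, ∀ ω ∈ 𝒢 i, ∀ f, P (tmk 𝒜 ω f))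
    (x : Twisted 𝒜 F) : P x :=
  tw_induction h0 hadd (fun ω f => hom_induction 𝒢 (P := fun ω => P (tmk 𝒜 ω f)) (by simpa using h0)
    (fun x y hx hy => by rw [map_add]; exact hadd _ _ hx hy) (fun i x hx => h i x hx f) ω) x

variable (𝒜) in
theorem sgn_mul_sgn (ω η : Ω) : sgn 𝒜 (ω * η) = sgn 𝒜 ω * sgn 𝒜 η := by
  refine hom_induction 𝒜 (P := fun ω => sgn 𝒜 (ω * η) = sgn 𝒜 ω * sgn 𝒜 η) (by simp)
    (fun x y hx hy => by simp only [add_mul, map_add, hx, hy]) (fun k ω hω => ?_) ω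
  refine hom_induction 𝒜 (P := fun η => sgn 𝒜 (ω * η) = sgn 𝒜 ω * sgn 𝒜 η) (by simp)
    (fun x y hx hy => by simp only [mul_add, map_add, hx, hy]) (fun l η hη => ?_) η
  rw [sgn_of_mem 𝒜 hω, sgn_of_mem 𝒜 hη, sgn_of_mem 𝒜 (SetLike.mul_mem_graded hω hη),
    smul_mul_smul_comm, pow_add]

variable (𝒜) in
theorem sgn_sgn (ω : Ω) : sgn 𝒜 (sgn 𝒜 ω) = ω := by
  refine hom_induction 𝒜 (P := fun ω => sgn 𝒜 (sgn 𝒜 ω) = ω) (by simp)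
    (fun x y hx hy => by simp only [map_add, hx, hy]) (fun k ω hω => ?_) ω
  rw [sgn_of_mem 𝒜 hω, map_smul, sgn_of_mem 𝒜 hω, smul_smul, ← mul_pow]
  norm_num

theorem sgn_derivation {δ : Ω →ₗ[ℂ] Ω} (h : ∀ k, ∀ ω ∈ 𝒜 k, δ ω ∈ 𝒜 (k + 1)) (ω : Ω) :
    sgn 𝒜 (δ ω) = - δ (sgn 𝒜 ω) := by
  refine hom_induction 𝒜 (P := fun ω => sgn 𝒜 (δ ω) = - δ (sgn 𝒜 ω)) (by simp)
    (fun x y hx hy => by simp only [map_add, hx, hy]; abel) (fun k ω hω => ?_) ω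
  rw [sgn_of_mem 𝒜 hω, sgn_of_mem 𝒜 (h k ω hω), map_smul, pow_succ, mul_neg_one, neg_smul]

namespace Connection

variable {δ : Ω →ₗ[ℂ] Ω} {W : Submodule ℂ Ω} (N : Connection 𝒜 F δ W)
  (hδ : IsGradedDerivation 𝒜 δ)

theorem ext_lmul (η : Ω) (x : Twisted 𝒜 F) :
    N.ext hδ (lmul η x) = lmul (δ η) x + lmul (sgn 𝒜 η) (N.ext hδ x) := by
  refine tw_induction
    (P := fun x => N.ext hδ (lmul η x) = lmul (δ η) x + lmul (sgn 𝒜 η) (N.ext hδ x)) (by simp)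
    (fun x y hx hy => by simp only [map_add, hx, hy]; abel) (fun ω f => ?_) x
  rw [lmul_tmk, ext_tmk, ext_tmk, lmul_tmk, hδ.sgn_rule, map_add, map_add, lmul_tmk, lmul_lmul,
    sgn_mul_sgn, LinearMap.add_apply, add_assoc]

/-- The two cross terms `δ ω ∧ ∇ f` cancel because the grading involution anticommutes with `δ`. The
square of the extended connection is therefore determined by the curvature. -/
theorem ext_ext_tmk (h1 : ∀ k, ∀ ω ∈ 𝒜 k, δ ω ∈ 𝒜 (k + 1)) (h2 : ∀ ω, δ (δ ω) = 0) (ω : Ω)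
    (f : F) : N.ext hδ (N.ext hδ (tmk 𝒜 ω f)) = lmul ω (N.curvature hδ f) := by
  rw [ext_tmk, map_add, ext_tmk, ext_lmul, h2, sgn_sgn, sgn_derivation h1]
  simp [curvature]

theorem ext_mem_formsIn {V V' : Submodule ℂ Ω} (h1 : ∀ ω ∈ V, δ ω ∈ V')
    (h2 : ∀ ω ∈ V, ∀ η ∈ W, sgn 𝒜 ω * η ∈ V') {x : Twisted 𝒜 F} (hx : x ∈ formsIn F V) :
    N.ext hδ x ∈ formsIn F V' := by
  refine formsIn_induction (P := fun x => N.ext hδ x ∈ formsIn F V') (by simp)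
    (fun x y hx hy => by rw [map_add]; exact add_mem hx hy) (fun ω hω f => ?_) hx
  rw [ext_tmk]
  exact add_mem (tmk_mem_formsIn (h1 ω hω) f) (lmul_mem_formsIn (h2 ω hω) (N.mem f))

end Connection

namespace HermitianModule

variable {C : StarCalculus 𝒜} [IsScalarTower ℂ (𝒜 0) F] (H : HermitianModule F C)

theorem contract_lmul (k : F) (ω : Ω) (x : Twisted 𝒜 F) :
    H.contract k (lmul ω x) = ω * H.contract k x := by
  refine tw_induction (P := fun x => H.contract k (lmul ω x) = ω * H.contract k x) (by simp)
    (fun x y hx hy => by simp only [map_add, hx, hy, mul_add]) (fun η f => ?_) x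
  rw [lmul_tmk, contract_tmk, contract_tmk, mul_assoc]

theorem hermForm_lmul (ω : Ω) (x y : Twisted 𝒜 F) :
    H.hermForm (lmul ω x) y = ω * H.hermForm x y := by
  refine tw_induction (P := fun y => H.hermForm (lmul ω x) y = ω * H.hermForm x y) (by simp)
    (fun y y' h h' => by simp only [map_add, h, h', mul_add]) (fun ν k => ?_) y
  rw [hermForm_tmk, hermForm_tmk, contract_lmul, mul_assoc]

theorem hermForm_lmul_of_mem {p q : ℕ} {ν : Ω} (hν : ν ∈ 𝒜 p) (x : Twisted 𝒜 F)
    {y : Twisted 𝒜 F} (hy : y ∈ formsIn F (𝒜 q)) :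
    H.hermForm x (lmul ν y) = (-1 : ℂ) ^ (p * q) • (H.hermForm x y * C.conj ν) := by
  refine formsIn_induction
    (P := fun y => H.hermForm x (lmul ν y) = (-1 : ℂ) ^ (p * q) • (H.hermForm x y * C.conj ν))
    (by simp) (fun y y' h h' => by simp only [map_add, h, h', add_mul, smul_add])
    (fun η hη k => ?_) hy
  rw [lmul_tmk, hermForm_tmk, hermForm_tmk, C.conj_mul _ _ _ hν _ hη, mul_smul_comm, mul_assoc]

theorem contract_mem {W : Submodule ℂ Ω} (hW : ∀ ω ∈ W, ∀ b : 𝒜 0, ω * b ∈ W) (k : F)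
    {x : Twisted 𝒜 F} (hx : x ∈ formsIn F W) : H.contract k x ∈ W :=
  formsIn_induction (P := fun x => H.contract k x ∈ W) (by simp)
    (fun x y hx hy => by rw [map_add]; exact add_mem hx hy) (fun ω hω f => hW ω hω _) hx

theorem hermForm_mem_total {p q : ℕ} {x y : Twisted 𝒜 F} (hx : x ∈ formsIn F (𝒜 p))
    (hy : y ∈ formsIn F (𝒜 q)) : H.hermForm x y ∈ 𝒜 (p + q) := by
  refine formsIn_induction (P := fun y => H.hermForm x y ∈ 𝒜 (p + q)) (by simp)
    (fun x y hx hy => by rw [map_add]; exact add_mem hx hy) (fun ν hν k => ?_) hy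
  rw [hermForm_tmk]
  refine SetLike.mul_mem_graded (H.contract_mem (fun ω hω b => ?_) k hx) (C.conj_mem _ _ hν)
  simpa using SetLike.mul_mem_graded hω b.2

/-- The graded Leibniz rule for the extension of an Hermitian structure, for a pair of
connections that are Hermitian conjugate to each other. -/
theorem hermForm_leibniz {δ δ' : Ω →ₗ[ℂ] Ω} {W W' : Submodule ℂ Ω}
    (hδ : IsGradedDerivation 𝒜 δ) (hδ' : IsGradedDerivation 𝒜 δ')
    (N : Connection 𝒜 F δ W) (N' : Connection 𝒜 F δ' W') (hW' : W' ≤ 𝒜 1)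
    (hconj : ∀ ω, C.conj (δ' ω) = δ (C.conj ω))
    (hN : ∀ f k, δ (H.toDual k f : 𝒜 0) =
      H.hermForm (N.map f) (tmk 𝒜 1 k) + H.hermForm (tmk 𝒜 1 f) (N'.map k))
    {p : ℕ} {x : Twisted 𝒜 F} (hx : x ∈ formsIn F (𝒜 p)) (z : Twisted 𝒜 F) :
    δ (H.hermForm x z) =
      H.hermForm (N.ext hδ x) z + (-1 : ℂ) ^ p • H.hermForm x (N'.ext hδ' z) := by
  refine formsIn_induction (P := fun x => δ (H.hermForm x z) =
      H.hermForm (N.ext hδ x) z + (-1 : ℂ) ^ p • H.hermForm x (N'.ext hδ' z)) (by simp)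
    (fun x y hx hy => by simp only [map_add, LinearMap.add_apply, hx, hy, smul_add]; abel)
    (fun ω hω f => ?_) hx
  refine formsIn_hom_induction 𝒜 (P := fun z => δ (H.hermForm (tmk 𝒜 ω f) z) =
      H.hermForm (N.ext hδ (tmk 𝒜 ω f)) z + (-1 : ℂ) ^ p • H.hermForm (tmk 𝒜 ω f) (N'.ext hδ' z))
    (by simp) (fun x y hx hy => by simp only [map_add, hx, hy, smul_add]; abel)
    (fun q ν hν k => ?_) z
  have hωh : ω * (H.toDual k f : 𝒜 0) ∈ 𝒜 p := by
    simpa using SetLike.mul_mem_graded hω (H.toDual k f).2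
  have h1 : H.hermForm (N.map f) (tmk 𝒜 ν k) = H.hermForm (N.map f) (tmk 𝒜 1 k) * C.conj ν := by
    rw [hermForm_tmk, hermForm_one_right]
  -- The sign of the graded Leibniz rule for `ν` cancels the sign from reversing `ν` and a `1`-form
  -- under `*`.
  have h2 : H.hermForm (tmk 𝒜 ω f) (lmul (sgn 𝒜 ν) (N'.map k)) =
      ω * H.hermForm (tmk 𝒜 1 f) (N'.map k) * C.conj ν := by
    have e : tmk 𝒜 ω f = lmul ω (tmk 𝒜 1 f) := by rw [lmul_tmk, mul_one]
    rw [sgn_of_mem 𝒜 hν, map_smul, LinearMap.smul_apply, map_smulₛₗ,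
      hermForm_lmul_of_mem H hν _ (formsIn_mono hW' (N'.mem k)), e, hermForm_lmul, smul_smul]
    have : (starRingEnd ℂ) ((-1) ^ q) * (-1 : ℂ) ^ (q * 1) = 1 := by
      rw [map_pow, map_neg, map_one, mul_one, ← mul_pow]; norm_num
    rw [this, one_smul]
  have h3 : ∀ ω' ν', H.hermForm (tmk 𝒜 ω' f) (tmk 𝒜 ν' k) =
      ω' * (H.toDual k f : 𝒜 0) * C.conj ν' := fun _ _ => rfl
  rw [h3, hδ p _ hωh, hδ p _ hω, hN, Connection.ext_tmk, Connection.ext_tmk, map_add, map_add,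
    LinearMap.add_apply, h2, hermForm_lmul, h1, h3, h3, hconj, sgn_of_mem 𝒜 hω]
  simp only [smul_add, add_mul, mul_add, smul_mul_assoc, mul_assoc]
  abel

end HermitianModule

/-! ### Splitting the Chern connection by bidegree; `∂_F`, `∂̄_F` and the curvature identity. -/

section Bigraded

variable {C : StarCalculus 𝒜} {𝒷 : ℕ × ℕ → Submodule ℂ Ω} [GradedAlgebra 𝒷]
  {X : ComplexStructure C 𝒷}

/-- This is the `(a,b+2)`-component of `d² = 0`. -/
theorem ComplexStructure.delbar_delbar (X : ComplexStructure C 𝒷) (ω : Ω) :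
    X.delbar (X.delbar ω) = 0 := by
  refine hom_induction 𝒷 (P := fun ω => X.delbar (X.delbar ω) = 0) (by simp)
    (fun x y hx hy => by simp only [map_add, hx, hy, add_zero]) ?_ ω
  rintro ⟨a, b⟩ ω hω
  have h := C.d_d ω
  simp only [X.d_eq, LinearMap.add_apply, map_add] at h
  have h1 := X.del_mem _ _ _ hω
  have h2 := X.delbar_mem _ _ _ hω
  have h3 := congrArg (fun x => (DirectSum.decompose 𝒷 x (a, b + 1 + 1) : Ω)) h
  simp only [DirectSum.decompose_add, DirectSum.add_apply, Submodule.coe_add,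
    DirectSum.decompose_zero, DirectSum.zero_apply, Submodule.coe_zero] at h3
  rwa [DirectSum.decompose_of_mem_same 𝒷 (X.delbar_mem _ _ _ h2),
    DirectSum.decompose_of_mem_ne 𝒷 (X.del_mem _ _ _ h1) (by simp; omega),
    DirectSum.decompose_of_mem_ne 𝒷 (X.delbar_mem _ _ _ h1) (by simp),
    DirectSum.decompose_of_mem_ne 𝒷 (X.del_mem _ _ _ h2) (by simp), add_zero, zero_add,
    zero_add] at h3

theorem ComplexStructure.eq_of_add_eq_add {p q : ℕ × ℕ} (hpq : p ≠ q) {u u' v v' : Ω}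
    (hu : u ∈ 𝒷 p) (hu' : u' ∈ 𝒷 p) (hv : v ∈ 𝒷 q) (hv' : v' ∈ 𝒷 q) (h : u + v = u' + v') :
    u = u' ∧ v = v' := by
  have h1 : u - u' = v' - v := by
    rw [sub_eq_sub_iff_add_eq_add, h, add_comm]
  have h2 := eq_zero_of_mem_mem hpq (sub_mem hu hu') (h1 ▸ sub_mem hv' hv)
  exact ⟨sub_eq_zero.1 h2, (sub_eq_zero.1 (h1.symm.trans h2)).symm⟩

theorem ComplexStructure.del_mem_total (X : ComplexStructure C 𝒷) (k : ℕ) (ω : Ω) (hω : ω ∈ 𝒜 k) :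
    X.del ω ∈ 𝒜 (k + 1) := by
  rw [X.total] at hω
  refine Submodule.iSup_induction (motive := fun ω => X.del ω ∈ 𝒜 (k + 1)) _ hω ?_ (by simp)
    (fun x y hx hy => by rw [map_add]; exact add_mem hx hy)
  rintro ⟨a, b⟩ x hx
  by_cases hq : a + b = k
  · simp only [hq, iSup_pos] at hx
    have := X.mem_total (X.del_mem _ _ _ hx)
    rwa [show a + 1 + b = k + 1 by omega] at this
  · simp only [hq, iSup_neg, not_false_eq_true, Submodule.mem_bot] at hx
    simp [hx]

theorem ComplexStructure.delbar_mem_total (X : ComplexStructure C 𝒷) (k : ℕ) (ω : Ω)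
    (hω : ω ∈ 𝒜 k) : X.delbar ω ∈ 𝒜 (k + 1) := by
  have h := sub_mem (C.d_mem k ω hω) (X.del_mem_total k ω hω)
  rwa [X.d_eq, LinearMap.add_apply, add_sub_cancel_left] at h

theorem ComplexStructure.decompose_one_forms (X : ComplexStructure C 𝒷) {ω : Ω} (hω : ω ∈ 𝒜 1) :
    (DirectSum.decompose 𝒷 ω (1, 0) : Ω) + DirectSum.decompose 𝒷 ω (0, 1) = ω := by
  rw [X.total] at hω
  refine Submodule.iSup_induction (motive := fun ω =>
    (DirectSum.decompose 𝒷 ω (1, 0) : Ω) + DirectSum.decompose 𝒷 ω (0, 1) = ω) _ hω ?_ (by simp)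
    (fun x y hx hy => ?_)
  · rintro ⟨a, b⟩ x hx
    by_cases hq : a + b = 1
    · simp only [hq, iSup_pos] at hx
      obtain ⟨rfl, rfl⟩ | ⟨rfl, rfl⟩ : (a = 1 ∧ b = 0) ∨ (a = 0 ∧ b = 1) := by omega
      · rw [DirectSum.decompose_of_mem_same 𝒷 hx, DirectSum.decompose_of_mem_ne 𝒷 hx (by simp),
          add_zero]
      · rw [DirectSum.decompose_of_mem_same 𝒷 hx, DirectSum.decompose_of_mem_ne 𝒷 hx (by simp),
          zero_add]
    · simp only [hq, iSup_neg, not_false_eq_true, Submodule.mem_bot] at hx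
      simp [hx]
  · conv_rhs => rw [← hx, ← hy]
    simp only [DirectSum.decompose_add, DirectSum.add_apply, Submodule.coe_add]
    abel

theorem projF_ne {p q : ℕ × ℕ} (h : p ≠ q) {x : Twisted 𝒜 F} (hx : x ∈ formsIn F (𝒷 p)) :
    projF X q x = 0 := by
  refine formsIn_induction (P := fun x => projF X q x = 0) (by simp)
    (fun x y hx hy => by simp only [map_add, hx, hy, add_zero]) (fun ω hω f => ?_) hx
  rw [projF, mapLeft_tmk, GradedAlgebra.proj_apply, DirectSum.decompose_of_mem_ne 𝒷 hω h, map_zero,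
    LinearMap.zero_apply]

variable [IsScalarTower ℂ (𝒜 0) F] [Module.Finite (𝒜 0) F] [Module.Projective (𝒜 0) F]
  (H : HermitianModule F C) (hol : HolomorphicStructure F X)

theorem HermitianModule.chern_isChern : H.IsChern hol (H.chern hol) :=
  (H.exists_isChern hol).choose_spec

theorem chern_map_eq (f : F) :
    (H.chern hol).map f = (delPart X (H.chern hol)).map f + hol.map f := by
  have key : ∀ x ∈ formsIn F (𝒜 1), x = projF X (1, 0) x + projF X (0, 1) x := fun x hx => by
    refine formsIn_induction (P := fun x => x = projF X (1, 0) x + projF X (0, 1) x) (by simp)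
      (fun x y hx hy => ?_) (fun ω hω f => ?_) hx
    · conv_lhs => rw [hx, hy]
      simp only [map_add]
      abel
    · rw [projF, mapLeft_tmk, projF, mapLeft_tmk, GradedAlgebra.proj_apply,
        GradedAlgebra.proj_apply, ← LinearMap.add_apply, ← map_add, X.decompose_one_forms hω]
  rw [(H.chern_isChern hol).proj_eq]
  exact key _ ((H.chern hol).mem f)

theorem chern_ext_eq (x : Twisted 𝒜 F) :
    (H.chern hol).ext C.d_mul x = delF H hol x + delbarF hol x := by
  refine tw_induction (P := fun x => (H.chern hol).ext C.d_mul x = delF H hol x + delbarF hol x)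
    (by simp) (fun x y hx hy => by simp only [map_add, hx, hy]; abel) (fun ω f => ?_) x
  rw [delF, delbarF, Connection.ext_tmk, Connection.ext_tmk, Connection.ext_tmk, chern_map_eq,
    X.d_eq, LinearMap.add_apply, map_add, map_add, LinearMap.add_apply]
  abel

/-- These are the `(1,0)`- and `(0,1)`-parts of the Hermitian condition on `∇`. The conjugation in
the second slot of `h_F` exchanges the two types, so each part couples `∂_F` with `∂̄_F`. -/
theorem hermForm_del_and_delbar (f k : F) :
    X.del (H.toDual k f : 𝒜 0) = H.hermForm ((delPart X (H.chern hol)).map f) (tmk 𝒜 1 k) +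
      H.hermForm (tmk 𝒜 1 f) (hol.map k) ∧
    X.delbar (H.toDual k f : 𝒜 0) = H.hermForm (hol.map f) (tmk 𝒜 1 k) +
      H.hermForm (tmk 𝒜 1 f) ((delPart X (H.chern hol)).map k) := by
  have hB : ∀ p : ℕ × ℕ, ∀ ω ∈ 𝒷 p, ∀ b : 𝒜 0, ω * b ∈ 𝒷 p := fun p ω hω b => by
    simpa using SetLike.mul_mem_graded hω (X.bideg_zero b)
  have h := (H.chern_isChern hol).hermitian f k
  have hd : C.d (H.toDual k f : 𝒜 0) =
      X.del (H.toDual k f : 𝒜 0) + X.delbar (H.toDual k f : 𝒜 0) := by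
    rw [← LinearMap.add_apply, ← X.d_eq]
  rw [hd, chern_map_eq, chern_map_eq, map_add, map_add, LinearMap.add_apply] at h
  refine ComplexStructure.eq_of_add_eq_add (p := (1, 0)) (q := (0, 1)) (𝒷 := 𝒷) (by simp)
    (X.del_mem 0 0 _ (X.bideg_zero _)) (add_mem ?_ ?_) (X.delbar_mem 0 0 _ (X.bideg_zero _))
    (add_mem ?_ ?_) (h.trans (by abel))
  · rw [H.hermForm_one_right]
    exact H.contract_mem (hB _) k ((delPart X (H.chern hol)).mem f)
  · exact H.hermForm_mem X f (hol.mem k)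
  · rw [H.hermForm_one_right]
    exact H.contract_mem (hB _) k (hol.mem f)
  · rw [← H.conj_contract]
    exact X.conj_mem _ _ _ (H.contract_mem (hB _) f ((delPart X (H.chern hol)).mem k))

theorem delbar_hermForm {p : ℕ} {x : Twisted 𝒜 F} (hx : x ∈ formsIn F (𝒜 p)) (z : Twisted 𝒜 F) :
    X.delbar (H.hermForm x z) =
      H.hermForm (delbarF hol x) z + (-1 : ℂ) ^ p • H.hermForm x (delF H hol z) :=
  H.hermForm_leibniz X.delbar_derivation X.del_derivation hol.toConnection
    (delPart X (H.chern hol)) (fun _ h => X.mem_total h) X.conj_del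
    (fun f k => (hermForm_del_and_delbar H hol f k).2) hx z

theorem del_hermForm {p : ℕ} {x : Twisted 𝒜 F} (hx : x ∈ formsIn F (𝒜 p)) (z : Twisted 𝒜 F) :
    X.del (H.hermForm x z) =
      H.hermForm (delF H hol x) z + (-1 : ℂ) ^ p • H.hermForm x (delbarF hol z) :=
  H.hermForm_leibniz X.del_derivation X.delbar_derivation (delPart X (H.chern hol))
    hol.toConnection (fun _ h => X.mem_total h) X.conj_delbar
    (fun f k => (hermForm_del_and_delbar H hol f k).1) hx z

theorem delbarF_mem {a b : ℕ} {x : Twisted 𝒜 F} (hx : x ∈ formsIn F (𝒷 (a, b))) :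
    delbarF hol x ∈ formsIn F (𝒷 (a, b + 1)) := by
  refine hol.toConnection.ext_mem_formsIn X.delbar_derivation (X.delbar_mem a b)
    (fun ω hω η hη => ?_) hx
  rw [sgn_of_mem 𝒜 (X.mem_total hω), smul_mul_assoc]
  exact Submodule.smul_mem _ _ (SetLike.mul_mem_graded hω hη)

theorem delF_mem {a b : ℕ} {x : Twisted 𝒜 F} (hx : x ∈ formsIn F (𝒷 (a, b))) :
    delF H hol x ∈ formsIn F (𝒷 (a + 1, b)) := by
  refine (delPart X (H.chern hol)).ext_mem_formsIn X.del_derivation (X.del_mem a b)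
    (fun ω hω η hη => ?_) hx
  rw [sgn_of_mem 𝒜 (X.mem_total hω), smul_mul_assoc]
  exact Submodule.smul_mem _ _ (SetLike.mul_mem_graded hω hη)

theorem delbarF_delbarF (x : Twisted 𝒜 F) : delbarF hol (delbarF hol x) = 0 := by
  refine tw_induction (P := fun x => delbarF hol (delbarF hol x) = 0) (by simp)
    (fun x y hx hy => by simp only [map_add, hx, hy, add_zero]) (fun ω f => ?_) x
  rw [delbarF, Connection.ext_ext_tmk _ _ X.delbar_mem_total X.delbar_delbar, hol.flat]
  simp

namespace KahlerStructure

variable {n : ℕ} (K : KahlerStructure X n)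

theorem del_kappa_and_delbar_kappa : X.del K.kappa = 0 ∧ X.delbar K.kappa = 0 := by
  have h := K.closed
  rw [X.d_eq, LinearMap.add_apply] at h
  exact ComplexStructure.eq_of_add_eq_add (p := (2, 1)) (q := (1, 2)) (𝒷 := 𝒷) (by simp)
    (X.del_mem _ _ _ K.mem) (zero_mem _) (X.delbar_mem _ _ _ K.mem) (zero_mem _)
    (h.trans (add_zero 0).symm)

theorem derivation_kappa_pow {δ : Ω →ₗ[ℂ] Ω} (hδ : IsGradedDerivation 𝒜 δ)
    (h : δ K.kappa = 0) (p : ℕ) : δ (K.kappa ^ p) = 0 := by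
  induction p with
  | zero =>
    have := hδ 0 1 SetLike.GradedOne.one_mem 1
    rw [mul_one, mul_one, pow_zero, one_smul, one_mul] at this
    simpa using this
  | succ p ih =>
    rw [pow_succ, hδ _ _ (K.kappa_pow_mem_total p), ih, h]
    simp

theorem sgn_kappa_pow (p : ℕ) : sgn 𝒜 (K.kappa ^ p) = K.kappa ^ p := by
  rw [sgn_of_mem 𝒜 (K.kappa_pow_mem_total p), pow_mul, neg_one_sq, one_pow, one_smul]

theorem delF_lmul_kappa_pow (p : ℕ) (x : Twisted 𝒜 F) :
    delF H hol (lmul (K.kappa ^ p) x) = lmul (K.kappa ^ p) (delF H hol x) := by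
  rw [delF, Connection.ext_lmul,
    K.derivation_kappa_pow X.del_derivation K.del_kappa_and_delbar_kappa.1, sgn_kappa_pow, map_zero,
    LinearMap.zero_apply, zero_add]

theorem delbarF_lmul_kappa_pow (p : ℕ) (x : Twisted 𝒜 F) :
    delbarF hol (lmul (K.kappa ^ p) x) = lmul (K.kappa ^ p) (delbarF hol x) := by
  rw [delbarF, Connection.ext_lmul,
    K.derivation_kappa_pow X.delbar_derivation K.del_kappa_and_delbar_kappa.2, sgn_kappa_pow,
    map_zero, LinearMap.zero_apply, zero_add]

/-- The identity is the `(a+1,b+1)`-part of `∇² = θ i L`. The projection discards `∂_F²`, of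
bidegree `(a+2,b)`, so its vanishing need not be known. -/
theorem delF_delbarF {θ : ℝ} (hF : K.IsNegative H hol θ) {a b : ℕ} {x : Twisted 𝒜 F}
    (hx : x ∈ formsIn F (𝒷 (a, b))) :
    delF H hol (delbarF hol x) + delbarF hol (delF H hol x) =
      ((θ : ℂ) * Complex.I) • lmul K.kappa x := by
  have h : (H.chern hol).ext C.d_mul ((H.chern hol).ext C.d_mul x) =
      ((θ : ℂ) * Complex.I) • lmul K.kappa x := by
    refine tw_induction (P := fun x => (H.chern hol).ext C.d_mul ((H.chern hol).ext C.d_mul x) =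
      ((θ : ℂ) * Complex.I) • lmul K.kappa x) (by simp)
      (fun x y hx hy => by simp only [map_add, hx, hy, smul_add]) (fun ω f => ?_) x
    rw [Connection.ext_ext_tmk _ _ C.d_mem C.d_d, hF.2, map_smul, lmul_tmk, lmul_tmk, K.central]
  rw [chern_ext_eq, chern_ext_eq, map_add, map_add, delbarF_delbarF, add_zero] at h
  have h1 := delF_mem H hol hx
  have h2 := delbarF_mem hol hx
  have h3 : lmul K.kappa x ∈ formsIn F (𝒷 (a + 1, b + 1)) :=
    lmul_mem_formsIn (fun ω hω => by simpa using K.kappa_pow_mul_mem (p := 1) hω) hx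
  have h4 := congrArg (projF X (a + 1, b + 1)) h
  rwa [map_add, map_add, map_smul, HermitianModule.projF_same _ h3, projF_ne (by simp) (delF_mem H hol h1),
    HermitianModule.projF_same _ (delF_mem H hol h2), HermitianModule.projF_same _ (delbarF_mem hol h1), zero_add] at h4

end KahlerStructure

end Bigraded

end TwistedForms

/-! ### The coefficients of the Weil formula -/

/-- The coefficient of the Weil formula on `κ^j α`, for `α` primitive of bidegree `(a,b)` and
`l = n - j - (a + b)`. -/
def weilCoeff (a b j l : ℕ) : ℂ :=
  (-1 : ℂ) ^ ((a + b) * (a + b + 1) / 2) * Complex.I ^ ((a : ℤ) - (b : ℤ)) *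
    ((j.factorial : ℂ) / (l.factorial : ℂ))

theorem neg_one_pow_triangle_succ (k : ℕ) : (-1 : ℂ) ^ ((k + 1) * (k + 1 + 1) / 2) =
    (-1) ^ (k * (k + 1) / 2) * (-1) ^ (k + 1) := by
  rw [← pow_add, show (k + 1) * (k + 1 + 1) = k * (k + 1) + (k + 1) * 2 by ring,
    Nat.add_mul_div_right _ _ two_pos]

theorem neg_one_pow_mul_self (k : ℕ) : (-1 : ℂ) ^ k * (-1) ^ k = 1 := by
  rw [← mul_pow]; norm_num

/-- The constant in `∂̄_F^†` on `(0,k+1)`-forms, with `n = k + 1 + m`: the first factor is that of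
`∗` on such a form, the second that of `∗` on `κ^{m+1}` times a `(0,k)`-form. -/
theorem weilCoeff_mul_weilCoeff (k m : ℕ) :
    weilCoeff 0 (k + 1) 0 m * weilCoeff 0 k (m + 1) 0 = Complex.I * (m + 1) := by
  have hm : (m.factorial : ℂ) ≠ 0 := by exact_mod_cast m.factorial_ne_zero
  have hI : Complex.I ^ (((0 : ℕ) : ℤ) - ((k + 1 : ℕ) : ℤ)) * Complex.I ^ (((0 : ℕ) : ℤ) - (k : ℤ)) =
      -Complex.I * (-1) ^ k := by
    rw [← zpow_add₀ Complex.I_ne_zero, show ((0 : ℕ) : ℤ) - ((k + 1 : ℕ) : ℤ) +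
      (((0 : ℕ) : ℤ) - (k : ℤ)) = -1 + (-2) * (k : ℤ) by push_cast; ring,
      zpow_add₀ Complex.I_ne_zero, zpow_mul, zpow_neg_one, Complex.inv_I, zpow_natCast, zpow_neg,
      zpow_ofNat, Complex.I_sq]
    norm_num
  simp only [weilCoeff, zero_add, neg_one_pow_triangle_succ, Nat.factorial_zero, Nat.factorial_succ]
  calc _ = ((-1 : ℂ) ^ (k * (k + 1) / 2) * (-1) ^ (k * (k + 1) / 2)) * ((-1) ^ (k + 1)) *
      (Complex.I ^ (((0 : ℕ) : ℤ) - ((k + 1 : ℕ) : ℤ)) * Complex.I ^ (((0 : ℕ) : ℤ) - (k : ℤ))) *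
      ((m + 1) * (m.factorial / m.factorial)) := by push_cast; ring
    _ = ((-1) ^ k * (-1) ^ k) * (Complex.I * (m + 1)) := by
      rw [neg_one_pow_mul_self, hI, div_self hm]; ring
    _ = _ := by rw [neg_one_pow_mul_self, one_mul]

/-- The corresponding constant for `∂_F^†` on primitive `(1,k)`-forms, with `n = k + 1 + m`. -/
theorem weilCoeff_one_mul_weilCoeff (k m : ℕ) :
    weilCoeff 1 k 0 m * weilCoeff 0 k (m + 1) 0 = -Complex.I * (m + 1) := by
  have h : weilCoeff 1 k 0 m = -weilCoeff 0 (k + 1) 0 m := by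
    have hI : Complex.I ^ (((1 : ℕ) : ℤ) - (k : ℤ)) =
        -Complex.I ^ (((0 : ℕ) : ℤ) - ((k + 1 : ℕ) : ℤ)) := by
      rw [show ((1 : ℕ) : ℤ) - (k : ℤ) = 2 + (((0 : ℕ) : ℤ) - ((k + 1 : ℕ) : ℤ)) by push_cast; ring,
        zpow_add₀ Complex.I_ne_zero, zpow_ofNat, Complex.I_sq, neg_one_mul]
    simp only [weilCoeff, hI, zero_add, add_comm 1 k]
    ring
  rw [h, neg_mul, weilCoeff_mul_weilCoeff, neg_mul]

/-- With `n = k + m + 2`, this compares how `∗` acts on the two Lefschetz components of a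
`(1,k+1)`-form: the primitive one, and `κ` times a `(0,k)`-form. -/
theorem weilCoeff_one_eq (k m : ℕ) :
    weilCoeff 1 (k + 1) 0 m = -((m : ℂ) + 1) * weilCoeff 0 k 1 (m + 1) := by
  have hm : (m.factorial : ℂ) ≠ 0 := by exact_mod_cast m.factorial_ne_zero
  have hm' : (m : ℂ) + 1 ≠ 0 := by exact_mod_cast m.succ_ne_zero
  have hI : (((1 : ℕ) : ℤ) - ((k + 1 : ℕ) : ℤ)) = ((0 : ℕ) : ℤ) - (k : ℤ) := by push_cast; ring
  simp only [weilCoeff, hI, zero_add, show 1 + (k + 1) = k + 1 + 1 by ring,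
    neg_one_pow_triangle_succ, Nat.factorial_zero, Nat.factorial_succ]
  have hs : (-1 : ℂ) ^ (k + 1) * (-1) ^ (k + 1 + 1) = -1 := by
    rw [pow_succ _ (k + 1), ← mul_assoc, neg_one_pow_mul_self, one_mul]
  rw [mul_assoc ((-1 : ℂ) ^ (k * (k + 1) / 2)), hs]
  push_cast
  field_simp

/-! ### Weil formula and Lefschetz decomposition on twisted forms; codifferentials and the
Akizuki–Nakano identity. -/

section Operators

variable {Ω : Type*} [Ring Ω] [Algebra ℂ Ω] {𝒜 : ℕ → Submodule ℂ Ω} [GradedAlgebra 𝒜]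
  {C : StarCalculus 𝒜} {𝒷 : ℕ × ℕ → Submodule ℂ Ω} [GradedAlgebra 𝒷]
  {X : ComplexStructure C 𝒷}
  {F : Type*} [AddCommGroup F] [Module ℂ F] [Module (𝒜 0) F] [IsScalarTower ℂ (𝒜 0) F]

namespace KahlerStructure

variable {n : ℕ} {K : KahlerStructure X n}

variable (K) in
/-- The space of primitive forms of bidegree `(a,b)`. -/
def primitive (a b : ℕ) : Submodule ℂ Ω :=
  𝒷 (a, b) ⊓ LinearMap.ker (LinearMap.mulLeft ℂ (K.kappa ^ (n - (a + b) + 1)))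

theorem hodgeF_weil (hK : K.PositiveDefinite) {a b j l : ℕ} (h : j + (a + b) + l = n)
    {x : Twisted 𝒜 F} (hx : x ∈ formsIn F (K.primitive a b)) :
    hodgeF F hK (lmul (K.kappa ^ j) x) = weilCoeff a b j l • lmul (K.kappa ^ l) x := by
  refine formsIn_induction (P := fun x =>
    hodgeF F hK (lmul (K.kappa ^ j) x) = weilCoeff a b j l • lmul (K.kappa ^ l) x) (by simp)
    (fun x y hx hy => by simp only [map_add, hx, hy, smul_add]) (fun ω hω f => ?_) hx
  rw [lmul_tmk, hodgeF_tmk, hodge_kappa_pow_mul hK h hω.1 hω.2, lmul_tmk, map_smul,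
    LinearMap.smul_apply]
  rfl

theorem hodgeF_weil_zero (hK : K.PositiveDefinite) {b j l : ℕ} (h : j + b + l = n)
    {x : Twisted 𝒜 F} (hx : x ∈ formsIn F (𝒷 (0, b))) :
    hodgeF F hK (lmul (K.kappa ^ j) x) = weilCoeff 0 b j l • lmul (K.kappa ^ l) x := by
  refine hodgeF_weil hK (by omega)
    (HermitianModule.formsIn_mono (fun ω hω => Submodule.mem_inf.2 ⟨hω, K.primitive_zero (by omega) hω⟩) hx)

theorem formsIn_eq_zero (K : KahlerStructure X n) {a b : ℕ} (h : n < a ∨ n < b) {x : Twisted 𝒜 F}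
    (hx : x ∈ formsIn F (𝒷 (a, b))) : x = 0 :=
  formsIn_bot (fun _ => K.eq_zero_of_bidegree h) hx

theorem lmul_kappa_pow_mem (p : ℕ) {a b : ℕ} {x : Twisted 𝒜 F} (hx : x ∈ formsIn F (𝒷 (a, b))) :
    lmul (K.kappa ^ p) x ∈ formsIn F (𝒷 (a + p, b + p)) :=
  lmul_mem_formsIn (fun _ => K.kappa_pow_mul_mem) hx

theorem exists_eq_lmul_kappa_pow (K : KahlerStructure X n) {a b p : ℕ} (h : a + b + p = n)
    {x : Twisted 𝒜 F} (hx : x ∈ formsIn F (𝒷 (a + p, b + p))) :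
    ∃ y ∈ formsIn F (𝒷 (a, b)), x = lmul (K.kappa ^ p) y := by
  refine formsIn_induction (P := fun x => ∃ y ∈ formsIn F (𝒷 (a, b)), x = lmul (K.kappa ^ p) y)
    ⟨0, zero_mem _, by simp⟩ ?_ (fun ω hω f => ?_) hx
  · rintro _ _ ⟨y, hy, rfl⟩ ⟨y', hy', rfl⟩
    exact ⟨y + y', add_mem hy hy', by rw [map_add]⟩
  · obtain ⟨η, hη, rfl⟩ := K.exists_eq_kappa_pow_mul h hω
    exact ⟨_, tmk_mem_formsIn hη f, by rw [lmul_tmk]⟩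

/-- The Lefschetz decomposition of forms of bidegree `(1,b)`. -/
theorem exists_primitive_decomposition (K : KahlerStructure X n) {b : ℕ} (h : b + 2 ≤ n)
    {x : Twisted 𝒜 F} (hx : x ∈ formsIn F (𝒷 (1, b + 1))) :
    ∃ y ∈ formsIn F (K.primitive 1 (b + 1)), ∃ z ∈ formsIn F (𝒷 (0, b)),
      x = y + lmul (K.kappa ^ 1) z := by
  refine formsIn_induction (P := fun x => ∃ y ∈ formsIn F (K.primitive 1 (b + 1)),
    ∃ z ∈ formsIn F (𝒷 (0, b)), x = y + lmul (K.kappa ^ 1) z)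
    ⟨0, zero_mem _, 0, zero_mem _, by simp⟩ ?_ (fun ω hω f => ?_) hx
  · rintro _ _ ⟨y, hy, z, hz, rfl⟩ ⟨y', hy', z', hz', rfl⟩
    exact ⟨y + y', add_mem hy hy', z + z', add_mem hz hz', by rw [map_add]; abel⟩
  -- The obstruction to `ω` being primitive has bidegree `(n-b, n)`, hence is `κ^{n-b} η` with `η`
  -- of type `(0,b)`; subtracting `κ η` removes it.
  · have h1 := K.kappa_pow_mul_mem (p := n - (1 + (b + 1)) + 1) hω
    rw [show 1 + (n - (1 + (b + 1)) + 1) = 0 + (n - b) by omega,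
      show b + 1 + (n - (1 + (b + 1)) + 1) = b + (n - b) by omega] at h1
    obtain ⟨η, hη, he⟩ := K.exists_eq_kappa_pow_mul (by omega : 0 + b + (n - b) = n) h1
    have hp : ω - K.kappa ^ 1 * η ∈ K.primitive 1 (b + 1) := by
      refine ⟨sub_mem hω (by simpa using K.kappa_pow_mul_mem (p := 1) hη), ?_⟩
      rw [SetLike.mem_coe, LinearMap.mem_ker, LinearMap.mulLeft_apply, mul_sub, he, ← mul_assoc, ← pow_add,
        show n - (1 + (b + 1)) + 1 + 1 = n - b by omega, sub_self]
    refine ⟨tmk 𝒜 (ω - K.kappa ^ 1 * η) f, tmk_mem_formsIn hp f, tmk 𝒜 η f,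
      tmk_mem_formsIn hη f, ?_⟩
    rw [lmul_tmk, map_sub, LinearMap.sub_apply, sub_add_cancel]

theorem formsIn_primitive_of_zero (hn : 1 ≤ n) {x : Twisted 𝒜 F} (hx : x ∈ formsIn F (𝒷 (1, 0))) :
    x ∈ formsIn F (K.primitive 1 0) :=
  HermitianModule.formsIn_mono (fun ω hω => Submodule.mem_inf.2 ⟨hω, by
    rw [LinearMap.mem_ker, LinearMap.mulLeft_apply]
    exact K.eq_zero_of_bidegree (by omega) (K.kappa_pow_mul_mem hω)⟩) hx

/-! ### Adjoints -/

/-- On `q`-forms `∗∗ = (-1)^q`, and the integral vanishes unless `p + q = 2n`, in which case `p` and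
`q` have the same parity. -/
theorem integral_hermForm_hodgeF_hodgeF (hK : K.PositiveDefinite) (H : HermitianModule F C)
    (s : State C) {p : ℕ} {x : Twisted 𝒜 F} (hx : x ∈ formsIn F (𝒜 p)) (w : Twisted 𝒜 F) :
    K.integral s (H.hermForm x (hodgeF F hK (hodgeF F hK w))) =
      (-1) ^ p * K.integral s (H.hermForm x w) := by
  refine formsIn_hom_induction 𝒜
    (P := fun w => K.integral s (H.hermForm x (hodgeF F hK (hodgeF F hK w))) =
      (-1) ^ p * K.integral s (H.hermForm x w)) (by simp)
    (fun x y hx hy => by simp only [map_add, hx, hy, mul_add]) (fun q ν hν k => ?_) w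
  rw [hodgeF_tmk, hodgeF_tmk, hodge_hodge hK hν, map_smul, LinearMap.smul_apply, map_smulₛₗ,
    map_smul, smul_eq_mul]
  by_cases hpq : p + q = 2 * n
  · congr 1
    rw [map_pow, map_neg, map_one]
    calc (-1 : ℂ) ^ q = (-1) ^ (p + q) * (-1) ^ p := by
          rw [add_comm, pow_add, mul_assoc, neg_one_pow_mul_self, mul_one]
      _ = (-1) ^ p := by rw [hpq, pow_mul, neg_one_sq, one_pow, one_mul]
  · rw [integral_eq_zero hK s hpq (H.hermForm_mem_total hx (tmk_mem_formsIn hν k)), mul_zero,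
      mul_zero]

/-- Integrating the Leibniz rule with `z = ∗y` gives `⟨T x, y⟩ = -(-1)^p ∫ h_F(x, T' ∗ y)`.
Inserting `∗∗`, which costs a second `(-1)^p`, turns the right-hand side into a pairing with `-∗ T'
∗ y`. -/
theorem isAdjointF_of_leibniz (hK : K.PositiveDefinite) (H : HermitianModule F C) (s : State C)
    {δ : Ω →ₗ[ℂ] Ω} (hδ : ∀ ω, K.integral s (δ ω) = 0) {T T' : Twisted 𝒜 F →ₗ[ℂ] Twisted 𝒜 F}
    (h : ∀ p, ∀ x ∈ formsIn F (𝒜 p), ∀ z,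
      δ (H.hermForm x z) = H.hermForm (T x) z + (-1 : ℂ) ^ p • H.hermForm x (T' z)) :
    K.IsAdjointF H s T (-(hodgeF F hK ∘ₗ T' ∘ₗ hodgeF F hK)) := by
  intro x y
  refine formsIn_hom_induction 𝒜 (P := fun x : Twisted 𝒜 F => K.innerF H s (T x) y =
    K.innerF H s x ((-(hodgeF F hK ∘ₗ T' ∘ₗ hodgeF F hK)) y))
    (by simp only [map_zero, innerF_zero_left])
    (fun x x' h h' => by rw [map_add, innerF_add_left, innerF_add_left, h, h'])
    (fun p ω hω f => ?_) x
  have hx := tmk_mem_formsIn (𝒜 := 𝒜) (F := F) hω f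
  have h1 := congrArg (K.integral s) (h p _ hx (hodgeF F hK y))
  rw [hδ, map_add, map_smul, smul_eq_mul] at h1
  rw [innerF_eq_integral hK, innerF_eq_integral hK, LinearMap.neg_apply, LinearMap.comp_apply,
    LinearMap.comp_apply, map_neg, map_neg, map_neg, integral_hermForm_hodgeF_hodgeF hK H s hx]
  exact eq_neg_of_add_eq_zero_left h1.symm

variable [Module.Finite (𝒜 0) F] [Module.Projective (𝒜 0) F]
  (hK : K.PositiveDefinite) (H : HermitianModule F C) (s : State C) (hol : HolomorphicStructure F X)

/-- The codifferential `-∗ ∂_F ∗`. -/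
def codelbar : Twisted 𝒜 F →ₗ[ℂ] Twisted 𝒜 F :=
  -(hodgeF F hK ∘ₗ delF H hol ∘ₗ hodgeF F hK)

/-- The codifferential `-∗ ∂̄_F ∗`. -/
def codel : Twisted 𝒜 F →ₗ[ℂ] Twisted 𝒜 F :=
  -(hodgeF F hK ∘ₗ delbarF hol ∘ₗ hodgeF F hK)

theorem codelbar_apply (x : Twisted 𝒜 F) :
    codelbar hK H hol x = -hodgeF F hK (delF H hol (hodgeF F hK x)) := rfl

theorem codel_apply (x : Twisted 𝒜 F) :
    codel hK hol x = -hodgeF F hK (delbarF hol (hodgeF F hK x)) := rfl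

variable {s} in
theorem isAdjointF_codelbar (hs : K.ClosedIntegral s) :
    K.IsAdjointF H s (delbarF hol) (codelbar hK H hol) :=
  isAdjointF_of_leibniz hK H s (fun ω => (integral_del_and_delbar hK hs ω).2)
    (fun _ _ hx z => delbar_hermForm H hol hx z)

variable {s} in
theorem isAdjointF_codel (hs : K.ClosedIntegral s) :
    K.IsAdjointF H s (delF H hol) (codel hK hol) :=
  isAdjointF_of_leibniz hK H s (fun ω => (integral_del_and_delbar hK hs ω).1)
    (fun _ _ hx z => del_hermForm H hol hx z)

variable {H s} in
theorem isAdjointF_unique {T S S' : Twisted 𝒜 F →ₗ[ℂ] Twisted 𝒜 F} (hK : K.PositiveDefinite)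
    (h : K.IsAdjointF H s T S) (h' : K.IsAdjointF H s T S') : S = S' := by
  refine LinearMap.ext fun y => ?_
  rw [← sub_eq_zero]
  refine eq_zero_of_innerF H s hK fun x => ?_
  rw [innerF_sub_right, ← h, ← h', sub_self]

variable {H s} in
theorem dagger_eq {T S : Twisted 𝒜 F →ₗ[ℂ] Twisted 𝒜 F} (hK : K.PositiveDefinite)
    (h : K.IsAdjointF H s T S) : K.dagger H s T = S := by
  have h' : ∃ S, K.IsAdjointF H s T S := ⟨S, h⟩
  rw [dagger, dif_pos h']
  exact isAdjointF_unique hK h'.choose_spec h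

variable {s} in
-- The adjoint of `∂̄_F² = 0`, together with non-degeneracy.
theorem codelbar_codelbar (hs : K.ClosedIntegral s) (x : Twisted 𝒜 F) :
    codelbar hK H hol (codelbar hK H hol x) = 0 := by
  refine eq_zero_of_innerF H s hK fun y => ?_
  have h := isAdjointF_codelbar hK H hol hs
  rw [← h, ← h, delbarF_delbarF, innerF_zero_left]

/-! ### The Kähler identities on `Ω^{(0,•)}` -/

theorem codelbar_eq {b m : ℕ} (h : b + m = n) {x : Twisted 𝒜 F}
    (hx : x ∈ formsIn F (𝒷 (0, b))) : codelbar hK H hol x =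
      -(weilCoeff 0 b 0 m • hodgeF F hK (lmul (K.kappa ^ m) (delF H hol x))) := by
  have h1 := hodgeF_weil_zero hK (by omega : 0 + b + m = n) hx
  rw [pow_zero, lmul_one] at h1
  rw [codelbar_apply, h1, map_smul, map_smul, delF_lmul_kappa_pow]

/-- The Kähler identity `∂̄_F^† = -i Λ ∂_F` without `Λ`: a `z` as in the last hypothesis stands for
`Λ ∂_F x` up to the factor `m + 1 = n - b`, by which `Λ L` acts on `(0,b)`-forms. -/
theorem codelbar_eq_smul {b m : ℕ} (h : b + 1 + m = n) {x z : Twisted 𝒜 F}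
    (hx : x ∈ formsIn F (𝒷 (0, b + 1))) (hz : z ∈ formsIn F (𝒷 (0, b)))
    (hxz : lmul (K.kappa ^ m) (delF H hol x) = lmul (K.kappa ^ (m + 1)) z) :
    codelbar hK H hol x = -(Complex.I * (m + 1)) • z := by
  rw [codelbar_eq hK H hol h hx, hxz,
    hodgeF_weil_zero hK (by omega : m + 1 + b + 0 = n) hz, smul_smul, weilCoeff_mul_weilCoeff,
    pow_zero, lmul_one, neg_smul]

theorem codelbar_zero {x : Twisted 𝒜 F} (hx : x ∈ formsIn F (𝒷 (0, 0))) :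
    codelbar hK H hol x = 0 := by
  have h1 : lmul (K.kappa ^ n) (delF H hol x) = 0 :=
    K.formsIn_eq_zero (by omega) (K.lmul_kappa_pow_mem n (delF_mem H hol hx))
  rw [codelbar_eq hK H hol (zero_add n) hx, h1, map_zero, smul_zero, neg_zero]

theorem codelbar_mem {b : ℕ} {x : Twisted 𝒜 F} (hx : x ∈ formsIn F (𝒷 (0, b + 1))) :
    codelbar hK H hol x ∈ formsIn F (𝒷 (0, b)) := by
  rcases lt_or_ge n (b + 1) with h | h
  · rw [K.formsIn_eq_zero (Or.inr h) hx, map_zero]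
    exact zero_mem _
  · obtain ⟨m, hm⟩ := Nat.exists_eq_add_of_le h
    have h1 := K.lmul_kappa_pow_mem m (delF_mem H hol hx)
    rw [show 0 + 1 + m = 0 + (m + 1) by omega, show b + 1 + m = b + (m + 1) by omega] at h1
    obtain ⟨z, hz, he⟩ := K.exists_eq_lmul_kappa_pow (by omega) h1
    rw [codelbar_eq_smul hK H hol hm.symm hx hz he]
    exact Submodule.smul_mem _ _ hz

theorem codelbar_of_delF_eq_zero {b : ℕ} {x : Twisted 𝒜 F} (hx : x ∈ formsIn F (𝒷 (0, b)))
    (h0 : delF H hol x = 0) : codelbar hK H hol x = 0 := by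
  rcases lt_or_ge n b with h | h
  · rw [K.formsIn_eq_zero (Or.inr h) hx, map_zero]
  · obtain ⟨m, hm⟩ := Nat.exists_eq_add_of_le h
    rw [codelbar_eq hK H hol hm.symm hx, h0, map_zero, map_zero, smul_zero, neg_zero]

/-- Collects what `laplace_identity` needs about the Lefschetz components of `∂_F x`, uniformly in
`b`. For `b = 0` one takes `z = 0`. The last equation carries the factor `-(m+1)` so that the
coefficient of `∗(κ z)`, which involves `b - 1`, need not be named. -/
theorem exists_delF_decomposition {b m : ℕ} (h : b + m + 1 = n) {x : Twisted 𝒜 F}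
    (hx : x ∈ formsIn F (𝒷 (0, b))) :
    ∃ y ∈ formsIn F (K.primitive 1 b), ∃ z, delF H hol x = y + lmul (K.kappa ^ 1) z ∧
      delbarF hol z ∈ formsIn F (𝒷 (0, b)) ∧
      codelbar hK H hol x = -(Complex.I * (m + 2)) • z ∧
      (-((m : ℂ) + 1)) • hodgeF F hK (lmul (K.kappa ^ 1) z) =
        weilCoeff 1 b 0 m • lmul (K.kappa ^ (m + 1)) z := by
  have hd := delF_mem H hol hx
  cases b with
  | zero =>
    refine ⟨_, formsIn_primitive_of_zero (by omega) hd, 0, by simp, by simp, ?_, by simp⟩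
    rw [codelbar_zero hK H hol hx, smul_zero]
  | succ b =>
    obtain ⟨y, hy, z, hz, he⟩ := K.exists_primitive_decomposition (by omega) hd
    refine ⟨y, hy, z, he, delbarF_mem hol hz, ?_, ?_⟩
    · have h1 := codelbar_eq_smul hK H hol (m := m + 1) (by omega) hx hz ?_
      · rw [h1]
        push_cast
        congr 3
        ring
      -- The exponent `m + 1` is exactly the one in the definition of primitivity for type
      -- `(1,b+1)`.
      · have hy0 : lmul (K.kappa ^ (m + 1)) y = 0 := by
          refine formsIn_induction (P := fun y => lmul (K.kappa ^ (m + 1)) y = 0) (by simp)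
            (fun x y hx hy => by rw [map_add, hx, hy, add_zero]) (fun ω hω f => ?_) hy
          have h2 : K.kappa ^ (n - (1 + (b + 1)) + 1) * ω = 0 := hω.2
          rw [show n - (1 + (b + 1)) + 1 = m + 1 by omega] at h2
          rw [lmul_tmk, h2, map_zero, LinearMap.zero_apply]
        rw [he, map_add, hy0, zero_add, lmul_lmul, ← pow_add]
    · rw [hodgeF_weil_zero hK (by omega : 1 + b + (m + 1) = n) hz, smul_smul, weilCoeff_one_eq]

/-- The Akizuki–Nakano identity on `Ω^{(0,b)}`, for `b < n`. -/
theorem laplace_identity {θ : ℝ} (hF : K.IsNegative H hol θ) {b m : ℕ} (h : b + m + 1 = n)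
    {x : Twisted 𝒜 F} (hx : x ∈ formsIn F (𝒷 (0, b))) :
    delbarF hol (codelbar hK H hol x) + codelbar hK H hol (delbarF hol x) =
      ((θ : ℂ) * (m + 1)) • x + codel hK hol (delF H hol x) := by
  obtain ⟨y, hy, z, he, hz, hS, hw⟩ := exists_delF_decomposition hK H hol h hx
  have hm : (-((m : ℂ) + 1)) ≠ 0 := neg_ne_zero.2 (by exact_mod_cast m.succ_ne_zero)
  have h1 := K.lmul_kappa_pow_mem m (delbarF_mem hol (delF_mem H hol hx))
  rw [show 0 + 1 + m = 0 + (m + 1) by omega, show b + 1 + m = b + (m + 1) by omega] at h1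
  -- `γ` is `∂̄_F ∂_F x` divided by `κ`, after multiplication by `κ^m`. All terms of the identity
  -- will be expressed through `x`, `γ` and `∂̄_F z`.
  obtain ⟨γ, hγ, hγe⟩ := K.exists_eq_lmul_kappa_pow (by omega) h1
  -- The curvature identity replaces `∂_F ∂̄_F x` by `θ i κ x - ∂̄_F ∂_F x`; this is where `θ`
  -- enters.
  have h2 : codelbar hK H hol (delbarF hol x) =
      -(Complex.I * (m + 1)) • (((θ : ℂ) * Complex.I) • x - γ) := by
    refine codelbar_eq_smul hK H hol (by omega) (delbarF_mem hol hx)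
      (sub_mem (Submodule.smul_mem _ _ hx) hγ) ?_
    rw [map_sub, ← hγe, map_smul, pow_succ, ← lmul_lmul, ← map_smul, ← map_sub,
      ← K.delF_delbarF H hol hF hx, add_sub_cancel_right]
  have h3 : lmul (K.kappa ^ m) (delbarF hol y) = lmul (K.kappa ^ (m + 1)) (γ - delbarF hol z) := by
    rw [map_sub, ← hγe, he, map_add, delbarF_lmul_kappa_pow, map_add, lmul_lmul, ← pow_add,
      add_sub_cancel_right]
  have h4 : hodgeF F hK y = weilCoeff 1 b 0 m • lmul (K.kappa ^ m) y := by
    have := hodgeF_weil hK (by omega : 0 + (1 + b) + m = n) hy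
    rwa [pow_zero, lmul_one] at this
  have h5 : (-((m : ℂ) + 1)) • hodgeF F hK (delF H hol x) = weilCoeff 1 b 0 m •
      (lmul (K.kappa ^ (m + 1)) z - ((m : ℂ) + 1) • lmul (K.kappa ^ m) y) := by
    rw [he, map_add, smul_add, hw, h4]
    module
  have h6 : (-((m : ℂ) + 1)) • delbarF hol (hodgeF F hK (delF H hol x)) = weilCoeff 1 b 0 m •
      lmul (K.kappa ^ (m + 1)) (((m : ℂ) + 2) • delbarF hol z - ((m : ℂ) + 1) • γ) := by
    rw [← map_smul, h5, map_smul, map_sub, map_smul, delbarF_lmul_kappa_pow,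
      delbarF_lmul_kappa_pow, h3]
    simp only [map_sub, map_smul]
    module
  -- After cancelling `-(m+1)`, `∂_F^† ∂_F x = -i ((m+2) ∂̄_F z - (m+1) γ)`. These are the terms in
  -- `z` and `γ` coming from the Laplacian, which leaves only `θ (m+1) x`.
  have h7 : (-((m : ℂ) + 1)) • codel hK hol (delF H hol x) =
      (-((m : ℂ) + 1)) • (-Complex.I) •
        (((m : ℂ) + 2) • delbarF hol z - ((m : ℂ) + 1) • γ) := by
    rw [codel_apply, smul_neg, ← map_smul, h6, map_smul,
      hodgeF_weil_zero hK (by omega : m + 1 + b + 0 = n)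
        (sub_mem (Submodule.smul_mem _ _ hz) (Submodule.smul_mem _ _ hγ)),
      smul_smul, weilCoeff_one_mul_weilCoeff, pow_zero, lmul_one]
    module
  rw [h2, hS, smul_right_injective _ hm h7, map_smul]
  match_scalars <;> first | ring1 | linear_combination (-(θ : ℂ) * (m + 1)) * Complex.I_sq

end KahlerStructure

end Operators

/-! ### Eigenvectors and lower bounds for the Laplacian and the Dirac operator. -/

section Spectrum

variable {Ω : Type*} [Ring Ω] [Algebra ℂ Ω] {𝒜 : ℕ → Submodule ℂ Ω} [GradedAlgebra 𝒜]
  {C : StarCalculus 𝒜} {𝒷 : ℕ × ℕ → Submodule ℂ Ω} [GradedAlgebra 𝒷]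
  {X : ComplexStructure C 𝒷}
  {F : Type*} [AddCommGroup F] [Module ℂ F] [Module (𝒜 0) F]

theorem mem_antiholForms {b : ℕ} {x : Twisted 𝒜 F} (hx : x ∈ formsIn F (𝒷 (0, b))) :
    x ∈ antiholForms 𝒜 𝒷 F :=
  Submodule.span_mono
    (by rintro _ ⟨ω, hω, f, rfl⟩; exact ⟨ω, Submodule.mem_iSup_of_mem b hω, f, rfl⟩) hx

theorem antiholForms_induction {P : Twisted 𝒜 F → Prop} (h0 : P 0)
    (hadd : ∀ x y, P x → P y → P (x + y)) (h : ∀ b, ∀ x ∈ formsIn F (𝒷 (0, b)), P x)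
    {x : Twisted 𝒜 F} (hx : x ∈ antiholForms 𝒜 𝒷 F) : P x := by
  refine formsIn_induction h0 hadd (fun ω hω f => ?_) hx
  exact Submodule.iSup_induction (motive := fun ω => P (tmk 𝒜 ω f)) _ hω
    (fun b ω hω => h b _ (tmk_mem_formsIn hω f)) (by simpa using h0)
    (fun x y hx hy => by rw [map_add]; exact hadd _ _ hx hy)

namespace KahlerStructure

variable [IsScalarTower ℂ (𝒜 0) F] {n : ℕ} {K : KahlerStructure X n}

theorem sum_projF (K : KahlerStructure X n) {x : Twisted 𝒜 F} (hx : x ∈ antiholForms 𝒜 𝒷 F) :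
    ∑ b ∈ Finset.range (n + 1), projF X (0, b) x = x := by
  refine antiholForms_induction (𝒷 := 𝒷)
    (P := fun x => ∑ b ∈ Finset.range (n + 1), projF X (0, b) x = x) (by simp)
    (fun x y hx hy => by simp only [map_add, Finset.sum_add_distrib, hx, hy]) (fun b x hx => ?_) hx
  rcases lt_or_ge n b with h | h
  · rw [K.formsIn_eq_zero (Or.inr h) hx]
    simp
  · rw [Finset.sum_eq_single b (fun c _ hc => projF_ne (by simpa using hc.symm) hx)
      (fun hb => absurd (Finset.mem_range.2 (by omega)) hb), HermitianModule.projF_same _ hx]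

variable [Module.Finite (𝒜 0) F] [Module.Projective (𝒜 0) F]
  (H : HermitianModule F C) {s : State C} (hol : HolomorphicStructure F X)

theorem existsUnique_isAdjointF (hK : K.PositiveDefinite) (hs : K.ClosedIntegral s) :
    ∃! S, K.IsAdjointF H s (delbarF hol) S :=
  ⟨_, isAdjointF_codelbar hK H hol hs,
    fun _ h => isAdjointF_unique hK h (isAdjointF_codelbar hK H hol hs)⟩

theorem dirac_apply (hK : K.PositiveDefinite) (hs : K.ClosedIntegral s) (x : Twisted 𝒜 F) :
    K.dirac H s hol x = delbarF hol x + codelbar hK H hol x := by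
  rw [dirac, dagger_eq hK (isAdjointF_codelbar hK H hol hs), LinearMap.add_apply]

theorem laplacian_apply (hK : K.PositiveDefinite) (hs : K.ClosedIntegral s) (x : Twisted 𝒜 F) :
    K.laplacian H s hol x =
      delbarF hol (codelbar hK H hol x) + codelbar hK H hol (delbarF hol x) := by
  rw [laplacian, LinearMap.comp_apply, dirac_apply H hol hK hs, dirac_apply H hol hK hs, map_add,
    map_add, delbarF_delbarF, codelbar_codelbar hK H hol hs, zero_add, add_zero]

theorem dirac_mem_antiholForms (hK : K.PositiveDefinite) (hs : K.ClosedIntegral s)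
    {x : Twisted 𝒜 F} (hx : x ∈ antiholForms 𝒜 𝒷 F) :
    K.dirac H s hol x ∈ antiholForms 𝒜 𝒷 F := by
  refine antiholForms_induction (𝒷 := 𝒷) (P := fun x => K.dirac H s hol x ∈ antiholForms 𝒜 𝒷 F)
    (by simp) (fun x y hx hy => by rw [map_add]; exact add_mem hx hy) (fun b x hx => ?_) hx
  rw [dirac_apply H hol hK hs]
  refine add_mem (mem_antiholForms (delbarF_mem hol hx)) ?_
  cases b with
  | zero => rw [codelbar_zero hK H hol hx]; exact zero_mem _
  | succ b => exact mem_antiholForms (codelbar_mem hK H hol hx)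

theorem laplacian_mem (hK : K.PositiveDefinite) (hs : K.ClosedIntegral s) {b : ℕ}
    {x : Twisted 𝒜 F} (hx : x ∈ formsIn F (𝒷 (0, b))) :
    K.laplacian H s hol x ∈ formsIn F (𝒷 (0, b)) := by
  rw [laplacian_apply H hol hK hs]
  refine add_mem ?_ (codelbar_mem hK H hol (delbarF_mem hol hx))
  cases b with
  | zero => rw [codelbar_zero hK H hol hx, map_zero]; exact zero_mem _
  | succ b => exact delbarF_mem hol (codelbar_mem hK H hol hx)

/-- Because of this, the non-zero homogeneous components of an eigenvector are eigenvectors with the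
same eigenvalue. -/
theorem projF_laplacian (hK : K.PositiveDefinite) (hs : K.ClosedIntegral s) (c : ℕ)
    {x : Twisted 𝒜 F} (hx : x ∈ antiholForms 𝒜 𝒷 F) :
    projF X (0, c) (K.laplacian H s hol x) = K.laplacian H s hol (projF X (0, c) x) := by
  refine antiholForms_induction (𝒷 := 𝒷) (P := fun x =>
    projF X (0, c) (K.laplacian H s hol x) = K.laplacian H s hol (projF X (0, c) x)) (by simp)
    (fun x y hx hy => by simp only [map_add, hx, hy]) (fun b x hx => ?_) hx
  have h := laplacian_mem H hol hK hs hx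
  rcases eq_or_ne b c with rfl | hbc
  · rw [HermitianModule.projF_same _ hx, HermitianModule.projF_same _ h]
  · rw [projF_ne (by simpa using hbc) hx, projF_ne (by simpa using hbc) h, map_zero]

/-- In bidegree `(0,n-1)` the constant `θ (n - b)` of the Akizuki–Nakano identity is `θ`, and its
second term vanishes with `∂_F x`. -/
theorem laplacian_eq_smul (hK : K.PositiveDefinite) (hs : K.ClosedIntegral s) {θ : ℝ}
    (hF : K.IsNegative H hol θ) {b : ℕ} (h : b + 1 = n) {x : Twisted 𝒜 F}
    (hx : x ∈ formsIn F (𝒷 (0, b))) (h0 : delF H hol x = 0) :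
    K.laplacian H s hol x = (θ : ℂ) • x := by
  rw [laplacian_apply H hol hK hs, laplace_identity hK H hol hF (m := 0) h hx, h0, map_zero]
  simp

/-- The eigenvector `∂̄_F x + √θ x` of the Dolbeault–Dirac operator. -/
theorem dirac_eigenvector (hK : K.PositiveDefinite) (hs : K.ClosedIntegral s) {θ : ℝ}
    (hF : K.IsNegative H hol θ) {b : ℕ} (h : b + 1 = n) {x : Twisted 𝒜 F}
    (hx : x ∈ formsIn F (𝒷 (0, b))) (hx0 : x ≠ 0) (h0 : delF H hol x = 0) :
    K.dirac H s hol (delbarF hol x + (Real.sqrt θ : ℂ) • x) =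
      (Real.sqrt θ : ℂ) • (delbarF hol x + (Real.sqrt θ : ℂ) • x) ∧
    delbarF hol x + (Real.sqrt θ : ℂ) • x ≠ 0 := by
  have h1 : K.dirac H s hol x = delbarF hol x := by
    rw [dirac_apply H hol hK hs, codelbar_of_delF_eq_zero hK H hol hx h0, add_zero]
  have h2 : K.dirac H s hol (delbarF hol x) = (θ : ℂ) • x := by
    rw [← laplacian_eq_smul H hol hK hs hF h hx h0, laplacian, LinearMap.comp_apply, h1]
  constructor
  · rw [map_add, map_smul, h1, h2, smul_add, smul_smul, ← Complex.ofReal_mul,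
      Real.mul_self_sqrt hF.1.le, add_comm]
  · intro he
    -- The two summands have different bidegrees, so the `(0,b)`-component `√θ x` alone shows that
    -- the vector is non-zero.
    have h3 := congrArg (projF X (0, b)) he
    rw [map_add, map_smul, projF_ne (by simp) (delbarF_mem hol hx),
      HermitianModule.projF_same _ hx, map_zero, zero_add] at h3
    refine hx0 ((smul_eq_zero.1 h3).resolve_left ?_)
    exact_mod_cast (Real.sqrt_pos.2 hF.1).ne'

section Bounds

variable {H hol}

theorem im_innerF_self (hK : K.PositiveDefinite) (x : Twisted 𝒜 F) :
    (K.innerF H s x x).im = 0 :=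
  Complex.conj_eq_iff_im.1 (conj_innerF H s hK x x)

/-- Pairing the Akizuki–Nakano identity with `x` gives `μ ⟨x,x⟩ = θ (n-b) ⟨x,x⟩ + ⟨∂_F x, ∂_F x⟩`,
where `n - b ≥ 1` and the last term is non-negative. -/
theorem bound_of_lt_top (hK : K.PositiveDefinite) (hs : K.ClosedIntegral s) {θ : ℝ}
    (hF : K.IsNegative H hol θ) (hpos : ∀ x, x ≠ 0 → 0 < (K.innerF H s x x).re) {b : ℕ}
    (h : b < n) {x : Twisted 𝒜 F} (hx : x ∈ formsIn F (𝒷 (0, b))) (hx0 : x ≠ 0) {μ : ℂ}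
    (hμ : K.laplacian H s hol x = μ • x) : μ.im = 0 ∧ θ ≤ μ.re := by
  obtain ⟨m, rfl⟩ := Nat.exists_eq_add_of_lt h
  rw [laplacian_apply H hol hK hs, laplace_identity hK H hol hF rfl hx] at hμ
  have h1 := congrArg (fun y => K.innerF H s y x) hμ
  have h2 : K.innerF H s (codel hK hol (delF H hol x)) x =
      K.innerF H s (delF H hol x) (delF H hol x) := by
    rw [← conj_innerF H s hK, ← isAdjointF_codel hK H hol hs, conj_innerF H s hK]
  simp only [innerF_add_left, innerF_smul_left, h2] at h1
  have hN := hpos x hx0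
  have hM : 0 ≤ (K.innerF H s (delF H hol x) (delF H hol x)).re := by
    rcases eq_or_ne (delF H hol x) 0 with h0 | h0
    · rw [h0, innerF_zero_left, Complex.zero_re]
    · exact (hpos _ h0).le
  have e1 := congrArg Complex.re h1
  have e2 := congrArg Complex.im h1
  have e3 : (θ : ℂ) * ((m : ℂ) + 1) = ((θ * (m + 1) : ℝ) : ℂ) := by push_cast; ring
  rw [e3] at e1 e2
  simp only [Complex.add_re, Complex.add_im, Complex.mul_re, Complex.mul_im, Complex.ofReal_re,
    Complex.ofReal_im, im_innerF_self hK, zero_mul, mul_zero, add_zero, zero_add, sub_zero]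
    at e1 e2
  refine ⟨(mul_eq_zero.1 e2.symm).resolve_right hN.ne', ?_⟩
  have h3 : θ * (m + 1) ≤ μ.re := le_of_mul_le_mul_right (by linarith) hN
  have h4 : 0 ≤ θ * m := mul_nonneg hF.1.le m.cast_nonneg
  linarith

theorem bound_of_bidegree (hK : K.PositiveDefinite) (hs : K.ClosedIntegral s) (hn : 1 ≤ n) {θ : ℝ}
    (hF : K.IsNegative H hol θ) (hpos : ∀ x, x ≠ 0 → 0 < (K.innerF H s x x).re) {b : ℕ}
    {x : Twisted 𝒜 F} (hx : x ∈ formsIn F (𝒷 (0, b))) (hx0 : x ≠ 0) {μ : ℂ} (hμ0 : μ ≠ 0)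
    (hμ : K.laplacian H s hol x = μ • x) : μ.im = 0 ∧ θ ≤ μ.re := by
  rcases lt_trichotomy b n with h | rfl | h
  · exact bound_of_lt_top hK hs hF hpos h hx hx0 hμ
  · obtain ⟨b, rfl⟩ := Nat.exists_eq_add_of_le' hn
    have h1 : delbarF hol x = 0 := K.formsIn_eq_zero (by omega) (delbarF_mem hol hx)
    have h2 := hμ
    rw [laplacian_apply H hol hK hs, h1, map_zero, add_zero] at h2
    -- In top degree `Δ x = ∂̄_F ∂̄_F^† x = μ x` with `μ ≠ 0`, so `∂̄_F^† x` is a non-zero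
    -- eigenvector with the same eigenvalue one degree lower, where the previous bound applies.
    refine bound_of_lt_top hK hs hF hpos (Nat.lt_succ_self b) (codelbar_mem hK H hol hx) ?_
      (x := codelbar hK H hol x) ?_
    · intro h3
      rw [h3, map_zero] at h2
      exact smul_ne_zero hμ0 hx0 h2.symm
    · rw [laplacian_apply H hol hK hs, codelbar_codelbar hK H hol hs, map_zero, zero_add, h2,
        map_smul]
  · exact absurd (K.formsIn_eq_zero (Or.inr h) hx) hx0

theorem bound_of_antiholForms (hK : K.PositiveDefinite) (hs : K.ClosedIntegral s) (hn : 1 ≤ n)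
    {θ : ℝ} (hF : K.IsNegative H hol θ) (hpos : ∀ x, x ≠ 0 → 0 < (K.innerF H s x x).re)
    {x : Twisted 𝒜 F} (hx : x ∈ antiholForms 𝒜 𝒷 F) (hx0 : x ≠ 0) {μ : ℂ} (hμ0 : μ ≠ 0)
    (hμ : K.laplacian H s hol x = μ • x) : μ.im = 0 ∧ θ ≤ μ.re := by
  obtain ⟨b, -, hb⟩ : ∃ b ∈ Finset.range (n + 1), projF X (0, b) x ≠ 0 :=
    Finset.exists_ne_zero_of_sum_ne_zero (by rwa [K.sum_projF hx])
  refine bound_of_bidegree hK hs hn hF hpos (projF_mem X _ x) hb hμ0 ?_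
  rw [← projF_laplacian H hol hK hs b hx, hμ, map_smul]

end Bounds

end KahlerStructure

theorem hasEigenvalue_restrict_iff {V : Type*} [AddCommGroup V] [Module ℂ V] {T : V →ₗ[ℂ] V}
    {W : Submodule ℂ V} (hT : ∀ x ∈ W, T x ∈ W) {μ : ℂ} :
    Module.End.HasEigenvalue (T.restrict hT) μ ↔ ∃ x ∈ W, x ≠ 0 ∧ T x = μ • x := by
  constructor
  · intro h
    obtain ⟨x, hx⟩ := h.exists_hasEigenvector
    refine ⟨x, x.2, fun h => hx.2 (Subtype.ext h), ?_⟩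
    exact congrArg Subtype.val hx.apply_eq_smul
  · rintro ⟨x, hx, hx0, h⟩
    exact Module.End.hasEigenvalue_of_hasEigenvector (x := ⟨x, hx⟩)
      ⟨Module.End.mem_eigenspace_iff.2 (Subtype.ext h), fun h => hx0 (congrArg Subtype.val h)⟩

end Spectrum

end NCKahler
end

theorem mainTheorem9 {Ω F : Type*} [Ring Ω] [Algebra ℂ Ω]
    {𝒜 : ℕ → Submodule ℂ Ω} [GradedAlgebra 𝒜]
    {𝒷 : ℕ × ℕ → Submodule ℂ Ω} [GradedAlgebra 𝒷]
    (C : NCKahler.StarCalculus 𝒜) (X : NCKahler.ComplexStructure C 𝒷)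
    (n : ℕ) (hn : 1 ≤ n) (K : NCKahler.KahlerStructure X n) (hK : K.PositiveDefinite)
    (s : NCKahler.State C) (hs : K.ClosedIntegral s)
    [AddCommGroup F] [Module ℂ F] [Module (𝒜 0) F] [IsScalarTower ℂ (𝒜 0) F]
    [Module.Finite (𝒜 0) F] [Module.Projective (𝒜 0) F]
    (H : NCKahler.HermitianModule F C) (hol : NCKahler.HolomorphicStructure F X)
    (θ : ℝ) (hF : K.IsNegative H hol θ)
    (hα : ∃ α ∈ NCKahler.formsIn F (𝒷 (0, n - 1)),
      α ≠ 0 ∧ NCKahler.delF H hol α = 0) :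
    -- `∂̄_F` is adjointable, so that `D_{∂̄_F}` and `Δ_{∂̄_F}` are the operators of the theory
    (∃! S, K.IsAdjointF H s (NCKahler.delbarF hol) S) ∧
    -- both operators restrict to `Ω^{(0,•)} ⊗_B F`, with eigenvalues `√θ` and `θ`
    ∃ (hD : ∀ x ∈ NCKahler.antiholForms 𝒜 𝒷 F,
          K.dirac H s hol x ∈ NCKahler.antiholForms 𝒜 𝒷 F)
      (hL : ∀ x ∈ NCKahler.antiholForms 𝒜 𝒷 F,
          K.laplacian H s hol x ∈ NCKahler.antiholForms 𝒜 𝒷 F),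
      Module.End.HasEigenvalue ((K.laplacian H s hol).restrict hL) (θ : ℂ) ∧
      Module.End.HasEigenvalue ((K.dirac H s hol).restrict hD) (Real.sqrt θ : ℂ) ∧
      -- these are the smallest absolute values of non-zero eigenvalues
      ((∀ x, x ≠ 0 → 0 < (K.innerF H s x x).re) →
        (∀ μ : ℂ, Module.End.HasEigenvalue ((K.laplacian H s hol).restrict hL) μ → μ ≠ 0 →
          μ.im = 0 ∧ θ ≤ μ.re) ∧
        (∀ μ : ℂ, Module.End.HasEigenvalue ((K.dirac H s hol).restrict hD) μ → μ ≠ 0 →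
          Real.sqrt θ ≤ ‖μ‖)) := by
  have hD : ∀ x ∈ NCKahler.antiholForms 𝒜 𝒷 F, K.dirac H s hol x ∈ NCKahler.antiholForms 𝒜 𝒷 F :=
    fun x hx => NCKahler.KahlerStructure.dirac_mem_antiholForms H hol hK hs hx
  have hL : ∀ x ∈ NCKahler.antiholForms 𝒜 𝒷 F,
      K.laplacian H s hol x ∈ NCKahler.antiholForms 𝒜 𝒷 F := fun x hx => hD _ (hD x hx)
  obtain ⟨α, hα, hα0, hdα⟩ := hα
  have hn' : n - 1 + 1 = n := Nat.sub_add_cancel hn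
  have hm := NCKahler.mem_antiholForms hα
  obtain ⟨he, he0⟩ := NCKahler.KahlerStructure.dirac_eigenvector H hol hK hs hF hn' hα hα0 hdα
  refine ⟨NCKahler.KahlerStructure.existsUnique_isAdjointF H hol hK hs, hD, hL,
    (NCKahler.hasEigenvalue_restrict_iff hL).2 ⟨α, hm, hα0,
      NCKahler.KahlerStructure.laplacian_eq_smul H hol hK hs hF hn' hα hdα⟩,
    (NCKahler.hasEigenvalue_restrict_iff hD).2 ⟨_, add_mem
      (NCKahler.mem_antiholForms (NCKahler.delbarF_mem hol hα)) (Submodule.smul_mem _ _ hm),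
      he0, he⟩, fun hpos => ⟨fun μ hμ hμ0 => ?_, fun μ hμ hμ0 => ?_⟩⟩
  · obtain ⟨x, hx, hx0, hxμ⟩ := (NCKahler.hasEigenvalue_restrict_iff hL).1 hμ
    exact NCKahler.KahlerStructure.bound_of_antiholForms hK hs hn hF hpos hx hx0 hμ0 hxμ
  · obtain ⟨x, hx, hx0, hxμ⟩ := (NCKahler.hasEigenvalue_restrict_iff hD).1 hμ
    -- Since `Δ = D²`, the bound for `Δ` gives `θ ≤ Re μ² ≤ |μ|²`; neither self-adjointness of `D`
    -- nor reality of `μ` is needed.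
    have hxμ2 : K.laplacian H s hol x = (μ * μ) • x := by
      rw [NCKahler.KahlerStructure.laplacian, LinearMap.comp_apply, hxμ, map_smul, hxμ, smul_smul]
    have hb := (NCKahler.KahlerStructure.bound_of_antiholForms hK hs hn hF hpos hx hx0
      (mul_ne_zero hμ0 hμ0) hxμ2).2
    refine Real.sqrt_le_iff.2 ⟨norm_nonneg μ, hb.trans ?_⟩
    rw [sq, ← norm_mul]
    exact Complex.re_le_norm _
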